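/- Let $\Gamma=PSL(2,\mathbb Z)$ and let $X,Y\in\Gamma$ be the classes of $\begin{pmatrix}-1&1\\-1&0\end{pmatrix}$ and $\begin{pmatrix}0&-1\\1&0\end{pmatrix}$. A factorization of length $r$ is a sequence $\bar m=(m_1,\dots,m_r)$ of elements of $\Gamma$; it is simple if every $m_i$ is conjugate to $XY$; its monodromy at infinity is $m_r\cdots m_1$ and its monodromy group is $\langle m_1,\dots,m_r\rangle\subset\Gamma$. Two factorizations are strongly equivalent if they are related by a finite sequence of Hurwitz moves $(\dots,m_i,m_{i+1},\dots)\mapsto(\dots,m_i^{-1}m_{i+1}m_i,m_i,\dots)$ and their inverses, and weakly equivalent if global conjugations $(m_i)\mapsto(g^{-1}m_ig)$, $g\in\Gamma$, are allowed as well. Fix an integer $k\ge0$. Let $\Xi\subset S^2$ be a tree with $k$ trivalent and $k+2$ monovalent vertices (leaves) and no other vertices, and let $v_1$ be one of its leaves. Number the leaves $v_1,\dots,v_{k+2}$ consecutively in the clockwise direction, let $m_i$ ($1\le i\le k+1$) be the number of vertices, both ends included, of the shortest left turn path in $\Xi$ from $v_i$ to $v_{i+1}$, and put $n_i=m_i+\dots+m_{k+1}$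 (so $n_{k+2}=0$). For $s\in\mathbb Z$ let $\bar m(\Xi,v_1,s)$ be the factorization of length $k+2$ with entries $$(XY)^{s+n_i}\,(X^2YX^{-1})\,(XY)^{-s-n_i},\qquad i=1,\dots,k+2,$$ and let $\mathcal F_k$ be the set of all these factorizations, for all $\Xi$, $v_1$, $s$. All elements of $\mathcal F_k$ are simple and have monodromy at infinity $(XY)^{-5k-4}$ and a monodromy group of index $6(k+1)$ in $\Gamma$, and two of them are strongly equivalent if and only if their monodromy groups are equal. Theorem. The elements of $\mathcal F_k$ form exactly $T(k)$ weak equivalence classes, where $T(k)$ is the number of isotopy classes of trees $\Xi\subset S^2$ with $k$ trivalent and $k+2$ monovalent vertices (and no other vertices). The classes are distinguished by the conjugacy classes of the monodromy groups: two elements of $\mathcal F_k$ are weakly equivalent if and only if their monodromy groups are conjugate in $\Gamma$. This is the case if and only if the underlying trees are isotopic. -/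

import Mathlib

/-- The modular group `Γ = PSL(2, ℤ) = SL(2, ℤ) / {± id}`. -/
abbrev ModGroup : Type := Matrix.ProjectiveSpecialLinearGroup (Fin 2) ℤ

namespace ModGroup

/-- The matrix `[-1 1; -1 0]`. -/
def matX : Matrix.SpecialLinearGroup (Fin 2) ℤ :=
  ⟨!![-1, 1; -1, 0], by simp [Matrix.det_fin_two]⟩

/-- The matrix `[0 -1; 1 0]`. -/
def matY : Matrix.SpecialLinearGroup (Fin 2) ℤ :=
  ⟨!![0, -1; 1, 0], by simp [Matrix.det_fin_two]⟩

/-- The generator `X` of `Γ`, of order `3`. -/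
def X : ModGroup := QuotientGroup.mk matX

/-- The generator `Y` of `Γ`, of order `2`. -/
def Y : ModGroup := QuotientGroup.mk matY

end ModGroup

/-! ### Braid monodromy factorizations

A `G`-valued factorization of length `r` is a list of `r` elements of `G`. -/

namespace BM

/-- One Hurwitz move `(…, a, b, …) ↦ (…, a⁻¹ b a, a, …)`. -/
inductive HurwitzMove {G : Type*} [Group G] : List G → List G → Prop
  | move (l₁ : List G) (a b : G) (l₂ : List G) :
      HurwitzMove (l₁ ++ a :: b :: l₂) (l₁ ++ (a⁻¹ * b * a) :: a :: l₂)

/-- Global conjugation `(m_i) ↦ (g⁻¹ m_i g)`. -/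
def IsGlobalConj {G : Type*} [Group G] (l l' : List G) : Prop :=
  ∃ g : G, l' = l.map fun m => g⁻¹ * m * g

/-- Strong (Hurwitz) equivalence: a finite sequence of Hurwitz moves and their inverses. -/
def StrongEquiv {G : Type*} [Group G] : List G → List G → Prop :=
  Relation.EqvGen HurwitzMove

/-- Weak equivalence: a finite sequence of Hurwitz moves, their inverses, and global
conjugations. -/
def weakSetoid (G : Type*) [Group G] : Setoid (List G) :=
  Relation.EqvGen.setoid fun l l' => HurwitzMove l l' ∨ IsGlobalConj l l'

/-- Weak equivalence of two factorizations. -/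
def WeakEquiv {G : Type*} [Group G] (l l' : List G) : Prop := weakSetoid G l l'

/-- The monodromy at infinity `m_r ⋯ m_1` (the order of multiplication is reversed). -/
def atInfinity {G : Type*} [Group G] (l : List G) : G := l.reverse.prod

/-- The monodromy group, generated by the entries. -/
def monodromyGroup {G : Type*} [Group G] (l : List G) : Subgroup G :=
  Subgroup.closure {m | m ∈ l}

/-- Two subgroups are conjugate in `G`. -/
def ConjSubgroups {G : Type*} [Group G] (H H' : Subgroup G) : Prop :=
  ∃ g : G, H' = H.map (MulAut.conj g).toMonoidHom

/-- A `Γ`-valued factorization is simple if each entry is conjugate to `XY`. -/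
def IsSimple (l : List ModGroup) : Prop :=
  ∀ m ∈ l, IsConj (ModGroup.X * ModGroup.Y) m

end BM

/-! ### Plane trees -/

/-- A plane tree with `k` trivalent vertices, `k + 2` monovalent vertices and no other vertices,
given by its rotation system, i.e. by its set of edge ends (half-edges) with two permutations.
There are `2k + 1` edges, hence `4k + 2` edge ends. The permutation `op` sends an edge end to the
other end of the same edge, and `nx` sends it to the next end, counterclockwise, at the same
vertex. Thus edges are the cycles of `op` and vertices are the cycles of `nx`. Every rotation
system on a tree comes from an embedding into the oriented sphere, unique up to isotopy. -/
structure PlaneTree (k : ℕ) where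
  /-- the other end of the same edge -/
  op : Equiv.Perm (Fin (4 * k + 2))
  /-- the next end at the same vertex -/
  nx : Equiv.Perm (Fin (4 * k + 2))
  op_op : ∀ d, op (op d) = d
  op_ne : ∀ d, op d ≠ d
  /-- every vertex has valency `1` or `3` -/
  nx_nx_nx : ∀ d, nx (nx (nx d)) = d
  /-- there are `k + 2` monovalent vertices -/
  card_leaves : Nat.card {d // nx d = d} = k + 2
  /-- the graph is connected -/
  connected : MulAction.IsPretransitive (Subgroup.closure {op, nx}) (Fin (4 * k + 2))
  /-- a connected graph is a tree if and only if it has one more vertex than it has edges -/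
  euler : Nat.card (Quotient (Equiv.Perm.SameCycle.setoid nx)) =
    Nat.card (Quotient (Equiv.Perm.SameCycle.setoid op)) + 1

namespace PlaneTree

variable {k : ℕ}

/-- Two plane trees are isotopic if some bijection of their edge ends respects the edges and the
cyclic orders at the vertices. -/
def Isotopic (t t' : PlaneTree k) : Prop :=
  ∃ f : Equiv.Perm (Fin (4 * k + 2)),
    (∀ d, f (t.op d) = t'.op (f d)) ∧ ∀ d, f (t.nx d) = t'.nx (f d)

/-- Isotopy is an equivalence relation. -/
def isotopySetoid (k : ℕ) : Setoid (PlaneTree k) where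
  r := Isotopic
  iseqv :=
    { refl := fun _ => ⟨1, fun _ => rfl, fun _ => rfl⟩
      symm := by
        rintro t t' ⟨f, h₁, h₂⟩
        refine ⟨f.symm, fun d => ?_, fun d => ?_⟩
        · rw [Equiv.symm_apply_eq, h₁, Equiv.apply_symm_apply]
        · rw [Equiv.symm_apply_eq, h₂, Equiv.apply_symm_apply]
      trans := by
        rintro t t' t'' ⟨f, h₁, h₂⟩ ⟨g, h₃, h₄⟩
        refine ⟨f.trans g, fun d => ?_, fun d => ?_⟩
        · simp [h₁, h₃]
        · simp [h₂, h₄] }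

/-- `T(k)`: the number of isotopy classes of plane trees with `k` trivalent and `k + 2`
monovalent vertices. -/
noncomputable def T (k : ℕ) : ℕ := Nat.card (Quotient (isotopySetoid k))

/-- The leaves (monovalent vertices) of the tree, each one identified with the only edge end
at it. -/
def IsLeaf (t : PlaneTree k) (d : Fin (4 * k + 2)) : Prop := t.nx d = d

/-- One step of a left turn path: follow the edge to its other end and turn left, i.e. to the
next end in the clockwise direction. -/
def leftTurn (t : PlaneTree k) : Equiv.Perm (Fin (4 * k + 2)) := t.nx⁻¹ * t.op

/-- The number of edges in the shortest left turn path that starts at the end `d` and terminates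
at a leaf. -/
noncomputable def pathLength (t : PlaneTree k) (d : Fin (4 * k + 2)) : ℕ :=
  sInf {j : ℕ | 0 < j ∧ t.IsLeaf ((t.leftTurn ^ j) d)}

/-- The leaf next to the leaf `d` in the clockwise direction. -/
noncomputable def nextLeaf (t : PlaneTree k) (d : Fin (4 * k + 2)) : Fin (4 * k + 2) :=
  (t.leftTurn ^ t.pathLength d) d

/-- The vertex distance from the leaf `d` to the next leaf: the number of vertices in the shortest
left turn path from `d` to the next leaf, both leaves included. -/
noncomputable def vertexDist (t : PlaneTree k) (d : Fin (4 * k + 2)) : ℕ := t.pathLength d + 1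

/-- For the leaves `v_1 = v, v_2, …, v_{k+2}` numbered clockwise and `m_i` the vertex distance
from `v_i` to `v_{i+1}`, this is `n_{i+1} = m_{i+1} + ⋯ + m_{k+1}` for `i = 0, …, k + 1`
(so that `n_{k+2} = 0`). -/
noncomputable def distToLast (t : PlaneTree k) (v : Fin (4 * k + 2)) (i : ℕ) : ℕ :=
  ∑ j ∈ Finset.Ico i (k + 1), t.vertexDist (t.nextLeaf^[j] v)

open ModGroup in
/-- The factorization `(m_1, …, m_{k+2})`, `m_i = (XY)^{n_i} (X² Y X⁻¹) (XY)^{-n_i}`, of the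
marked tree `(t, v)`. -/
noncomputable def baseFactorization (t : PlaneTree k) (v : Fin (4 * k + 2)) : List ModGroup :=
  (List.range (k + 2)).map fun i =>
    (X * Y) ^ t.distToLast v i * (X ^ 2 * Y * X⁻¹) * ((X * Y) ^ t.distToLast v i)⁻¹

open ModGroup in
/-- The factorization of `(t, v)` with base point moved by `(XY)^s` along the boundary of the
outer region: the conjugate `(XY)^s (m_1, …, m_{k+2}) (XY)^{-s}`. -/
noncomputable def factorization (t : PlaneTree k) (v : Fin (4 * k + 2)) (s : ℤ) :
    List ModGroup :=
  (t.baseFactorization v).map fun m => (X * Y) ^ s * m * ((X * Y) ^ s)⁻¹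

/-- The family of all the factorizations attached to plane trees with `k` trivalent vertices. -/
def family (k : ℕ) : Set (List ModGroup) :=
  {l | ∃ (t : PlaneTree k) (v : Fin (4 * k + 2)) (s : ℤ), t.IsLeaf v ∧ l = t.factorization v s}

end PlaneTree

/-! Attaching a loop at each leaf turns the tree into a trivalent graph (`Dessin`) with `6(k+1)`
edge ends. `Γ` acts on these ends transitively, `Y` flipping edges and `X` rotating vertices
clockwise; the action exists because `Γ` is the free product of `⟨X⟩` and `⟨Y⟩` (`exists_lift`). The
element `XY` follows the outer face, leading from one leaf to the next in as many steps as their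
vertex distance, and `X²YX⁻¹` fixes the tree end at every leaf. Hence all entries of a factorization
fix one common point, and by `monodromyGroup_eq_stabilizer` they generate its stabilizer `H`: a tree
is simply connected, so a `Γ`-valued potential exists on its ends, and modulo `H` it extends over
the loops to an equivariant map to `Γ ⧸ H`. The index of `H` is then the number of points.

If two monodromy groups are conjugate, the dessins are isomorphic as `Γ`-sets; an isomorphism
recognizes the loops and restricts to an isotopy of the trees (`exists_isotopy`). Conversely,
isotopic trees have the same factorizations up to the choice of the leaf and of `s`. Hurwitz moves
rotate a factorization, which passes to the next leaf and changes `s` (`strongEquiv_nextLeaf`); any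
other change of `s` is a global conjugation. If the groups are equal, the isomorphism also matches
the base points, and rotations alone suffice. In the other direction, Hurwitz moves preserve the
monodromy group and global conjugations conjugate it. -/

namespace ModGroup

/-! ### The modular group as a free product -/

theorem coe_matX : (matX : Matrix (Fin 2) (Fin 2) ℤ) = !![-1, 1; -1, 0] := rfl

theorem coe_matY : (matY : Matrix (Fin 2) (Fin 2) ℤ) = !![0, -1; 1, 0] := rfl

theorem X_pow_three : X ^ 3 = 1 := by
  have h : matX ^ 3 = 1 := by
    ext i j
    fin_cases i <;> fin_cases j <;> simp [coe_matX, pow_succ]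
  rw [X, ← QuotientGroup.mk_pow, h, QuotientGroup.mk_one]

theorem eq_or_eq_neg_of_mk_eq {M N : Matrix.SpecialLinearGroup (Fin 2) ℤ}
    (h : (QuotientGroup.mk M : ModGroup) = QuotientGroup.mk N) :
    (∀ i j, N i j = M i j) ∨ ∀ i j, N i j = -M i j := by
  rw [QuotientGroup.eq, Matrix.SpecialLinearGroup.mem_center_iff] at h
  obtain ⟨r, hr, hs⟩ := h
  have hN : (N : Matrix (Fin 2) (Fin 2) ℤ) = r • (M : Matrix (Fin 2) (Fin 2) ℤ) := by
    have h1 : N = M * (M⁻¹ * N) := by group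
    rw [h1, Matrix.SpecialLinearGroup.coe_mul, ← hs]
    ext i j
    rw [Matrix.scalar_apply, Matrix.mul_diagonal, Matrix.smul_apply, smul_eq_mul, mul_comm]
  have hr' : r = 1 ∨ r = -1 := by simpa using hr
  rcases hr' with rfl | rfl
  · left; intro i j; rw [hN]; simp
  · right; intro i j; rw [hN]; simp

theorem Y_mul_Y : Y * Y = 1 := by
  rw [Y, ← QuotientGroup.mk_mul, ← QuotientGroup.mk_one, QuotientGroup.eq,
    Matrix.SpecialLinearGroup.mem_center_iff]
  refine ⟨-1, by simp, ?_⟩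
  rw [mul_one, Matrix.SpecialLinearGroup.coe_inv, Matrix.SpecialLinearGroup.coe_mul]
  ext i j
  fin_cases i <;> fin_cases j <;> simp [coe_matY, Matrix.adjugate_fin_two]

theorem X_mul_X_mul_X : X * X * X = 1 := by
  rw [← X_pow_three, pow_succ, pow_two]

theorem closure_X_Y : Subgroup.closure {X, Y} = ⊤ := by
  have hS : Y = QuotientGroup.mk ModularGroup.S := by
    rw [Y]; congr 1
  have hT : X * Y = QuotientGroup.mk ModularGroup.T := by
    rw [X, Y, ← QuotientGroup.mk_mul]; congr 1
    ext i j
    fin_cases i <;> fin_cases j <;>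
      simp [coe_matX, coe_matY, ModularGroup.T]
  have hX : X ∈ Subgroup.closure {X, Y} := Subgroup.subset_closure (by simp)
  have hY : Y ∈ Subgroup.closure {X, Y} := Subgroup.subset_closure (by simp)
  have h := congrArg (Subgroup.map (QuotientGroup.mk'
    (Subgroup.center (Matrix.SpecialLinearGroup (Fin 2) ℤ)))) SpecialLinearGroup.SL2Z_generators
  rw [MonoidHom.map_closure, ← MonoidHom.range_eq_map, QuotientGroup.range_mk'] at h
  rw [eq_top_iff, ← h, Subgroup.closure_le]
  rintro _ ⟨g, rfl | rfl, rfl⟩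
  · simpa [← hS] using hY
  · simpa [← hT] using mul_mem hX hY

variable {P : Type*} [Group P]

/-- Alternating products of `Y X` and `Y X²` in `Γ`, together with the same words in `x`, `y`. -/
inductive AltWord (x y : P) : ModGroup → P → Prop
  | one : AltWord x y 1 1
  | left {γ : ModGroup} {p : P} : AltWord x y γ p → AltWord x y (Y * X * γ) (y * x * p)
  | right {γ : ModGroup} {p : P} :
      AltWord x y γ p → AltWord x y (Y * (X * X) * γ) (y * (x * x) * p)

/-- `YX` and `YX²` are represented by elementary matrices, lower and upper triangular, with entry
`-1` off the diagonal. Products keep the sign pattern, and each new letter makes the off-diagonal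
sum strictly negative. -/
theorem AltWord.exists_matrix {x y : P} {γ : ModGroup} {p : P} (h : AltWord x y γ p) :
    ∃ M : Matrix.SpecialLinearGroup (Fin 2) ℤ, γ = QuotientGroup.mk M ∧
      0 < M 0 0 ∧ M 0 1 ≤ 0 ∧ M 1 0 ≤ 0 ∧ 0 < M 1 1 ∧
      (p = 1 ∨ M 0 1 + M 1 0 < 0) := by
  induction h with
  | one => exact ⟨1, by simp⟩
  | left _ ih =>
    obtain ⟨M, rfl, h1, h2, h3, h4, h5⟩ := ih
    refine ⟨matY * matX * M, rfl, ?_⟩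
    have e00 : (matY * matX * M) 0 0 = M 0 0 := by
      simp [coe_matX, coe_matY, Matrix.mul_apply, Fin.sum_univ_two]
    have e01 : (matY * matX * M) 0 1 = M 0 1 := by
      simp [coe_matX, coe_matY, Matrix.mul_apply, Fin.sum_univ_two]
    have e10 : (matY * matX * M) 1 0 = -M 0 0 + M 1 0 := by
      simp [coe_matX, coe_matY, Matrix.mul_apply, Fin.sum_univ_two]
    have e11 : (matY * matX * M) 1 1 = -M 0 1 + M 1 1 := by
      simp [coe_matX, coe_matY, Matrix.mul_apply, Fin.sum_univ_two]
    rw [e00, e01, e10, e11]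
    omega
  | right _ ih =>
    obtain ⟨M, rfl, h1, h2, h3, h4, h5⟩ := ih
    refine ⟨matY⁻¹ * (matX * matX) * M, ?_, ?_⟩
    -- `Y` is represented here by `matY⁻¹ = -matY`, which gives the positive diagonal.
    · have : Y⁻¹ = Y := inv_eq_of_mul_eq_one_left Y_mul_Y
      nth_rw 1 [← this]
      rfl
    have e00 : (matY⁻¹ * (matX * matX) * M) 0 0 = M 0 0 - M 1 0 := by
      simp [coe_matX, coe_matY, Matrix.mul_apply, Fin.sum_univ_two, Matrix.SpecialLinearGroup.coe_inv,
        Matrix.adjugate_fin_two]; ring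
    have e01 : (matY⁻¹ * (matX * matX) * M) 0 1 = M 0 1 - M 1 1 := by
      simp [coe_matX, coe_matY, Matrix.mul_apply, Fin.sum_univ_two, Matrix.SpecialLinearGroup.coe_inv,
        Matrix.adjugate_fin_two]; ring
    have e10 : (matY⁻¹ * (matX * matX) * M) 1 0 = M 1 0 := by
      simp [coe_matX, coe_matY, Matrix.mul_apply, Fin.sum_univ_two, Matrix.SpecialLinearGroup.coe_inv,
        Matrix.adjugate_fin_two]
    have e11 : (matY⁻¹ * (matX * matX) * M) 1 1 = M 1 1 := by
      simp [coe_matX, coe_matY, Matrix.mul_apply, Fin.sum_univ_two, Matrix.SpecialLinearGroup.coe_inv,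
        Matrix.adjugate_fin_two]
    rw [e00, e01, e10, e11]
    omega

/-- Normal forms `X^a w Y^b` in `Γ`, together with the same words in `x`, `y`. -/
def NormalForm (x y : P) (γ : ModGroup) (p : P) : Prop :=
  ∃ γ' p', AltWord x y γ' p' ∧
    ∃ a b : ℕ, a < 3 ∧ b < 2 ∧ γ = X ^ a * γ' * Y ^ b ∧ p = x ^ a * p' * y ^ b

theorem NormalForm.mul_x {x y : P} (hx : x * x * x = 1) {γ : ModGroup} {p : P}
    (h : NormalForm x y γ p) : NormalForm x y (X * γ) (x * p) := by
  obtain ⟨γ', p', h', a, b, ha, hb, rfl, rfl⟩ := h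
  interval_cases a
  · exact ⟨γ', p', h', 1, b, by simp, hb, by simp [mul_assoc], by simp [mul_assoc]⟩
  · exact ⟨γ', p', h', 2, b, by simp, hb, by simp [pow_two, mul_assoc],
      by simp [pow_two, mul_assoc]⟩
  · refine ⟨γ', p', h', 0, b, by simp, hb, ?_, ?_⟩
    · rw [show X * (X ^ 2 * γ' * Y ^ b) = X * X * X * γ' * Y ^ b by simp [pow_two, mul_assoc],
        X_mul_X_mul_X]; simp
    · rw [show x * (x ^ 2 * p' * y ^ b) = x * x * x * p' * y ^ b by simp [pow_two, mul_assoc],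
        hx]; simp

theorem NormalForm.mul_y {x y : P} (hy : y * y = 1) {γ : ModGroup} {p : P}
    (h : NormalForm x y γ p) : NormalForm x y (Y * γ) (y * p) := by
  have hY := Y_mul_Y
  obtain ⟨γ', p', h', a, b, ha, hb, rfl, rfl⟩ := h
  interval_cases a
  · cases h' with
    | one =>
      interval_cases b
      · exact ⟨1, 1, .one, 0, 1, by simp, by simp, by simp, by simp⟩
      · exact ⟨1, 1, .one, 0, 0, by simp, by simp, by simp [hY], by simp [hy]⟩
    | @left γ p h' =>
      refine ⟨γ, p, h', 1, b, by simp, hb, ?_, ?_⟩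
      · simp [← mul_assoc, hY]
      · simp [← mul_assoc, hy]
    | @right γ p h' =>
      refine ⟨γ, p, h', 2, b, by simp, hb, ?_, ?_⟩
      · simp [← mul_assoc, hY, pow_two]
      · simp [← mul_assoc, hy, pow_two]
  · exact ⟨_, _, h'.left, 0, b, by simp, hb, by simp [mul_assoc], by simp [mul_assoc]⟩
  · exact ⟨_, _, h'.right, 0, b, by simp, hb, by simp [pow_two, mul_assoc],
      by simp [pow_two, mul_assoc]⟩

theorem NormalForm.eq_one {x y : P} {p : P} (h : NormalForm x y 1 p) : p = 1 := by
  obtain ⟨γ', p', h', a, b, ha, hb, h1, rfl⟩ := h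
  obtain ⟨M, rfl, h2, h3, h4, h5, h6⟩ := h'.exists_matrix
  have h7 : (QuotientGroup.mk M : ModGroup) =
      QuotientGroup.mk ((matX ^ a)⁻¹ * (matY ^ b)⁻¹) := by
    have : (QuotientGroup.mk M : ModGroup) = (X ^ a)⁻¹ * (Y ^ b)⁻¹ := by
      rw [eq_mul_inv_iff_mul_eq, eq_inv_iff_mul_eq_one, ← mul_eq_one_comm, ← mul_assoc, ← h1]
    rw [this]; rfl
  -- The sign pattern excludes every case except `a = b = 0` with the plus sign, where the
  -- off-diagonal entries vanish and so `p' = 1`.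
  interval_cases a <;> interval_cases b <;> rcases eq_or_eq_neg_of_mk_eq h7 with h | h <;>
    have e00 := h 0 0 <;> have e01 := h 0 1 <;> have e10 := h 1 0 <;> have e11 := h 1 1 <;>
    simp [coe_matX, coe_matY, Matrix.SpecialLinearGroup.coe_inv, pow_two, Matrix.mul_apply,
      Fin.sum_univ_two, Matrix.adjugate_fin_two] at e00 e01 e10 e11 <;>
    try omega
  have hp : p' = 1 := by
    rcases h6 with h6 | h6
    · exact h6
    · omega
  simp [hp]

/-- `Γ` is the free product of its subgroups generated by `X` and `Y`: the universal property. -/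
theorem exists_lift (x y : P) (hx : x * x * x = 1) (hy : y * y = 1) :
    ∃ ρ : ModGroup →* P, ρ X = x ∧ ρ Y = y := by
  -- `K` is the graph of the desired homomorphism. Its projection to `Γ` is onto because `X`, `Y`
  -- generate, and injective because a normal form of `1` has trivial second component.
  set K : Subgroup (ModGroup × P) := Subgroup.closure {(X, x), (Y, y)} with hK
  have hN : ∀ k ∈ K, NormalForm x y k.1 k.2 := by
    intro k hk
    have hX' : ((X, x) : ModGroup × P)⁻¹ = (X, x) * (X, x) :=
      inv_eq_of_mul_eq_one_left (by ext <;> simp [X_mul_X_mul_X, hx])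
    have hY' : ((Y, y) : ModGroup × P)⁻¹ = (Y, y) :=
      inv_eq_of_mul_eq_one_left (by ext <;> simp [Y_mul_Y, hy])
    induction hk using Subgroup.closure_induction_left with
    | one => exact ⟨1, 1, .one, 0, 0, by simp⟩
    | mul_left a ha b _ ih =>
      rcases ha with rfl | rfl
      · exact ih.mul_x hx
      · exact ih.mul_y hy
    | inv_mul_cancel a ha b _ ih =>
      rcases ha with rfl | rfl
      · rw [hX', mul_assoc]; exact (ih.mul_x hx).mul_x hx
      · rw [hY']; exact ih.mul_y hy
  let π : K →* ModGroup := (MonoidHom.fst ModGroup P).comp K.subtype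
  have hinj : Function.Injective π := by
    rw [injective_iff_map_eq_one]
    rintro ⟨⟨γ, p⟩, hk⟩ h
    have h' : γ = 1 := h
    subst h'
    have := (hN _ hk).eq_one
    simp only at this
    subst this
    rfl
  have hkx : (X, x) ∈ K := Subgroup.subset_closure (by simp)
  have hky : (Y, y) ∈ K := Subgroup.subset_closure (by simp)
  have hsurj : Function.Surjective π := by
    rw [← MonoidHom.range_eq_top, eq_top_iff, ← closure_X_Y, Subgroup.closure_le]
    rintro g (rfl | rfl)
    · exact ⟨⟨_, hkx⟩, rfl⟩
    · exact ⟨⟨_, hky⟩, rfl⟩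
  let e : K ≃* ModGroup := MulEquiv.ofBijective π ⟨hinj, hsurj⟩
  have hex : e.symm X = ⟨_, hkx⟩ := by rw [MulEquiv.symm_apply_eq]; rfl
  have hey : e.symm Y = ⟨_, hky⟩ := by rw [MulEquiv.symm_apply_eq]; rfl
  refine ⟨((MonoidHom.snd ModGroup P).comp K.subtype).comp e.symm.toMonoidHom, ?_, ?_⟩
  · simp [hex]
  · simp [hey]

end ModGroup

/-! ### Bridges, left turn walks and simple connectivity of plane trees -/

namespace PlaneTree

variable {k : ℕ} (t : PlaneTree k)

theorem nx_inv_apply (d : Fin (4 * k + 2)) : t.nx⁻¹ d = t.nx (t.nx d) := by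
  rw [Equiv.Perm.inv_eq_iff_eq, t.nx_nx_nx]

theorem leftTurn_apply (d : Fin (4 * k + 2)) : t.leftTurn d = t.nx (t.nx (t.op d)) := by
  rw [leftTurn, Equiv.Perm.mul_apply, nx_inv_apply]

theorem induction_of_mem {p : Fin (4 * k + 2) → Prop} {d : Fin (4 * k + 2)} (hd : p d)
    (hnx : ∀ x, p x → p (t.nx x)) (hop : ∀ x, p x → p (t.op x)) (x : Fin (4 * k + 2)) : p x := by
  have := t.connected
  obtain ⟨⟨g, hg⟩, rfl⟩ := MulAction.exists_smul_eq (Subgroup.closure {t.op, t.nx}) d x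
  change p (g d)
  induction hg using Subgroup.closure_induction_left with
  | one => exact hd
  | mul_left a ha b _ ih =>
    rcases ha with rfl | rfl
    · exact hop _ ih
    · exact hnx _ ih
  | inv_mul_cancel a ha b _ ih =>
    rcases ha with rfl | rfl
    · have : t.op⁻¹ (b d) = t.op (b d) := by rw [Equiv.Perm.inv_eq_iff_eq, t.op_op]
      rw [Equiv.Perm.mul_apply, this]; exact hop _ ih
    · rw [Equiv.Perm.mul_apply, nx_inv_apply]; exact hnx _ (hnx _ ih)

/-- The edge ends that can be reached from `op d` without crossing the edge of `d`. -/
inductive Side (d : Fin (4 * k + 2)) : Fin (4 * k + 2) → Prop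
  | base : Side d (t.op d)
  | nx {x : Fin (4 * k + 2)} : Side d x → Side d (t.nx x)
  | op {x : Fin (4 * k + 2)} : Side d x → x ≠ d → x ≠ t.op d → Side d (t.op x)

theorem sameCycle_op {x y : Fin (4 * k + 2)} (h : t.op.SameCycle x y) : y = x ∨ y = t.op x := by
  obtain ⟨i, rfl⟩ := h
  have h2 : t.op ^ 2 = 1 := by
    ext z; simp [pow_two, t.op_op]
  rcases Int.even_or_odd' i with ⟨j, rfl | rfl⟩
  · left
    rw [zpow_mul]; norm_cast; rw [h2]; simp
  · right
    rw [zpow_add, zpow_mul]; norm_cast; rw [h2]; simp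

/-- The graph of vertices of the tree, with the edge of `d` removed. -/
def cutGraph (d : Fin (4 * k + 2)) :
    SimpleGraph (Quotient (Equiv.Perm.SameCycle.setoid t.nx)) :=
  SimpleGraph.fromRel fun p q => ∃ x, x ≠ d ∧ x ≠ t.op d ∧
    Quotient.mk (Equiv.Perm.SameCycle.setoid t.nx) x = p ∧
    Quotient.mk (Equiv.Perm.SameCycle.setoid t.nx) (t.op x) = q

theorem mk_nx (x : Fin (4 * k + 2)) :
    Quotient.mk (Equiv.Perm.SameCycle.setoid t.nx) (t.nx x) = Quotient.mk _ x :=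
  Quotient.sound (s := Equiv.Perm.SameCycle.setoid t.nx)
    (Equiv.Perm.sameCycle_apply_left.2 (Equiv.Perm.SameCycle.refl _ _))

theorem cutGraph_reachable_op {d x : Fin (4 * k + 2)} (h1 : x ≠ d) (h2 : x ≠ t.op d) :
    (t.cutGraph d).Reachable (Quotient.mk _ x) (Quotient.mk _ (t.op x)) := by
  by_cases h : (Quotient.mk (Equiv.Perm.SameCycle.setoid t.nx) x) = Quotient.mk _ (t.op x)
  · rw [h]
  · refine SimpleGraph.Adj.reachable ?_
    rw [cutGraph, SimpleGraph.fromRel_adj]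
    exact ⟨h, Or.inl ⟨x, h1, h2, rfl, rfl⟩⟩

theorem Side.reachable {d x : Fin (4 * k + 2)} (h : t.Side d x) :
    (t.cutGraph d).Reachable (Quotient.mk _ (t.op d)) (Quotient.mk _ x) := by
  induction h with
  | base => exact .refl _
  | nx _ ih => rwa [mk_nx]
  | op _ h1 h2 ih => exact ih.trans (t.cutGraph_reachable_op h1 h2)

theorem card_cutGraph_edgeSet (d : Fin (4 * k + 2)) :
    Nat.card (t.cutGraph d).edgeSet + 1 ≤
      Nat.card (Quotient (Equiv.Perm.SameCycle.setoid t.op)) := by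
  classical
  let F : Quotient (Equiv.Perm.SameCycle.setoid t.op) →
      Sym2 (Quotient (Equiv.Perm.SameCycle.setoid t.nx)) :=
    Quotient.lift (fun x => s(Quotient.mk _ x, Quotient.mk _ (t.op x))) <| by
      intro x y h
      rcases t.sameCycle_op h with rfl | rfl
      · rfl
      · rw [t.op_op]; exact Sym2.eq_swap
  have hsub : (t.cutGraph d).edgeSet ⊆ F '' {Quotient.mk _ d}ᶜ := by
    intro e
    induction e using Sym2.ind with
    | _ p q =>
      rw [SimpleGraph.mem_edgeSet, cutGraph, SimpleGraph.fromRel_adj]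
      have key : ∀ x, x ≠ d → x ≠ t.op d → F (Quotient.mk _ x) ∈ F '' {Quotient.mk _ d}ᶜ := by
        intro x h1 h2
        refine ⟨_, fun h => ?_, rfl⟩
        rcases t.sameCycle_op (Quotient.exact (s := Equiv.Perm.SameCycle.setoid t.op) h).symm
          with h | h
        · exact h1 h
        · exact h2 h
      rintro ⟨-, ⟨x, h1, h2, rfl, rfl⟩ | ⟨x, h1, h2, rfl, rfl⟩⟩
      · exact key x h1 h2
      · rw [Sym2.eq_swap]; exact key x h1 h2
  have h1 : Nat.card (t.cutGraph d).edgeSet ≤ ({Quotient.mk _ d}ᶜ :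
      Set (Quotient (Equiv.Perm.SameCycle.setoid t.op))).ncard := by
    rw [Nat.card_coe_set_eq]
    exact (Set.ncard_le_ncard hsub).trans (Set.ncard_image_le)
  rw [Set.ncard_compl, Set.ncard_singleton] at h1
  have : Nonempty (Quotient (Equiv.Perm.SameCycle.setoid t.op)) := ⟨Quotient.mk _ d⟩
  have := Nat.card_pos (α := Quotient (Equiv.Perm.SameCycle.setoid t.op))
  omega

/-- Every edge of a tree is a bridge. -/
theorem not_side_self (d : Fin (4 * k + 2)) : ¬ t.Side d d := by
  intro hd
  have hconn : (t.cutGraph d).Connected := by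
    rw [SimpleGraph.connected_iff_exists_forall_reachable]
    refine ⟨Quotient.mk _ (t.op d), fun q => ?_⟩
    induction q using Quotient.ind with
    | _ x =>
    refine t.induction_of_mem (p := fun x => (t.cutGraph d).Reachable
      (Quotient.mk _ (t.op d)) (Quotient.mk _ x)) (d := d) hd.reachable
      (fun x h => by rwa [mk_nx]) (fun x h => ?_) x
    by_cases h1 : x = d
    · rw [h1]
    by_cases h2 : x = t.op d
    · rw [h2, t.op_op]; exact hd.reachable
    exact h.trans (t.cutGraph_reachable_op h1 h2)
  -- The graph would stay connected with one edge fewer, against the Euler characteristic.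
  have h1 := hconn.card_vert_le_card_edgeSet_add_one
  have h2 := t.card_cutGraph_edgeSet d
  have h3 := t.euler
  omega

theorem nx_op_ne (d : Fin (4 * k + 2)) : t.nx (t.op d) ≠ d := fun h =>
  t.not_side_self d (by simpa [h] using (Side.base (t := t) (d := d)).nx)

theorem nx_nx_op_ne (d : Fin (4 * k + 2)) : t.nx (t.nx (t.op d)) ≠ d := fun h =>
  t.not_side_self d (by simpa [h] using (Side.base (t := t) (d := d)).nx.nx)

theorem nx_nx_ne {d : Fin (4 * k + 2)} (hd : ¬ t.IsLeaf d) : t.nx (t.nx d) ≠ d := fun h =>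
  hd (by have := t.nx_nx_nx d; rwa [h] at this)

theorem side_of_side_nx {d e : Fin (4 * k + 2)} (he : t.Side d e) (h1 : e ≠ t.op d)
    (h2 : ¬ t.Side e (t.op d)) {z : Fin (4 * k + 2)} (hz : t.Side e z) : t.Side d z := by
  induction hz with
  | base => exact he.op (fun h => t.not_side_self d (h ▸ he)) h1
  | nx _ ih => exact ih.nx
  | @op z hz _ _ ih =>
    exact ih.op (fun h => t.not_side_self d (h ▸ ih)) fun h => h2 (h ▸ hz)

/-- The measure for the induction in `exists_walk_op`: the branches beyond an edge are smaller than
the part of the tree that contains them. -/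
theorem ncard_side_lt {d e : Fin (4 * k + 2)} (he : t.Side d e) (h1 : e ≠ t.op d)
    (h2 : ¬ t.Side e (t.op d)) : {z | t.Side e z}.ncard < {z | t.Side d z}.ncard := by
  refine Set.ncard_lt_ncard ⟨fun z hz => t.side_of_side_nx he h1 h2 hz, fun h => ?_⟩
  exact h2 (h (Side.base (t := t) (d := d)))

variable {P : Type*} [Group P]

open Classical in
/-- The left turn walk, recorded together with the product of the corresponding powers of
`x` and `y`. -/
noncomputable def skewTurn (x y : P) (s : Fin (4 * k + 2) × P) : Fin (4 * k + 2) × P :=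
  (t.leftTurn s.1, (if t.IsLeaf (t.leftTurn s.1) then y else x * y) * s.2)

theorem skewTurn_iterate_fst (x y : P) (n : ℕ) (s : Fin (4 * k + 2) × P) :
    ((t.skewTurn x y)^[n] s).1 = (t.leftTurn ^ n) s.1 := by
  induction n with
  | zero => rfl
  | succ n ih => rw [Function.iterate_succ_apply', skewTurn, ih, pow_succ', Equiv.Perm.mul_apply]

/-- `n` left turns lead from `p` to `q`, with product `h`, and stay in the set `S`. -/
def Walk (x y : P) (S : Fin (4 * k + 2) → Prop) (n : ℕ) (p q : Fin (4 * k + 2)) (h : P) : Prop :=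
  (∀ g, (t.skewTurn x y)^[n] (p, g) = (q, h * g)) ∧ ∀ i, 0 < i → i ≤ n → S ((t.leftTurn ^ i) p)

variable {t} in
theorem Walk.end_eq {x y : P} {S : Fin (4 * k + 2) → Prop} {n : ℕ} {p q : Fin (4 * k + 2)} {h : P}
    (w : t.Walk x y S n p q h) : (t.leftTurn ^ n) p = q := by
  have := t.skewTurn_iterate_fst x y n (p, 1)
  rw [w.1] at this
  exact this.symm

variable {t} in
theorem Walk.trans {x y : P} {S : Fin (4 * k + 2) → Prop} {m n : ℕ} {p q r : Fin (4 * k + 2)}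
    {h h' : P} (w : t.Walk x y S n p q h) (w' : t.Walk x y S m q r h') :
    t.Walk x y S (m + n) p r (h' * h) := by
  refine ⟨fun g => ?_, fun i h1 h2 => ?_⟩
  · rw [Function.iterate_add_apply, w.1, w'.1, mul_assoc]
  · by_cases h3 : i ≤ n
    · exact w.2 i h1 h3
    · obtain ⟨j, rfl⟩ := Nat.exists_eq_add_of_lt (not_le.1 h3)
      rw [show n + j + 1 = (j + 1) + n by omega, pow_add, Equiv.Perm.mul_apply, w.end_eq]
      exact w'.2 _ (by omega) (by omega)

variable {t} in
theorem Walk.mono {x y : P} {S S' : Fin (4 * k + 2) → Prop} {n : ℕ} {p q : Fin (4 * k + 2)}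
    {h : P} (w : t.Walk x y S n p q h) (hS : ∀ z, S z → S' z) : t.Walk x y S' n p q h :=
  ⟨w.1, fun i h1 h2 => hS _ (w.2 i h1 h2)⟩

theorem walk_one_of_isLeaf (x y : P) {S : Fin (4 * k + 2) → Prop} {p q : Fin (4 * k + 2)}
    (hpq : t.leftTurn p = q) (hq : t.IsLeaf q) (hS : S q) : t.Walk x y S 1 p q y := by
  refine ⟨fun g => by simp [skewTurn, hpq, hq], fun i h1 h2 => ?_⟩
  obtain rfl : i = 1 := by omega
  rwa [pow_one, hpq]

theorem walk_one_of_not_isLeaf (x y : P) {S : Fin (4 * k + 2) → Prop} {p q : Fin (4 * k + 2)}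
    (hpq : t.leftTurn p = q) (hq : ¬ t.IsLeaf q) (hS : S q) : t.Walk x y S 1 p q (x * y) := by
  refine ⟨fun g => by simp [skewTurn, hpq, hq], fun i h1 h2 => ?_⟩
  obtain rfl : i = 1 := by omega
  rwa [pow_one, hpq]

/-- Walking around the part of the tree beyond an edge amounts to crossing this edge. -/
theorem exists_walk_op {x y : P} (hx : x * x * x = 1) (hy : y * y = 1)
    (d : Fin (4 * k + 2)) : ∃ n, t.Walk x y (t.Side d) n d (t.op d) y := by
  induction hm : {z | t.Side d z}.ncard using Nat.strong_induction_on generalizing d with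
  | _ m ih =>
  subst hm
  have hb : t.Side d (t.op d) := .base
  by_cases hl : t.IsLeaf (t.op d)
  · exact ⟨1, t.walk_one_of_isLeaf x y (by rw [leftTurn_apply, hl, hl]) hl hb⟩
  · set b := t.nx (t.op d) with hb'
    set a := t.nx b with ha
    have had : t.nx a = t.op d := t.nx_nx_nx _
    have hla : ¬ t.IsLeaf a := fun h => hl (by
      have h' : t.op d = a := had.symm.trans h
      rwa [← h'] at h)
    have hlb : ¬ t.IsLeaf b := fun h => hl (t.nx.injective h)
    have hna : a ≠ t.op d := t.nx_nx_ne hl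
    obtain ⟨n, hn⟩ := ih _ (t.ncard_side_lt hb.nx.nx hna
      fun h => t.not_side_self a h.nx.nx) a rfl
    obtain ⟨m, hm⟩ := ih _ (t.ncard_side_lt hb.nx hl fun h => t.not_side_self b h.nx) b rfl
    have w1 := t.walk_one_of_not_isLeaf x y (t.leftTurn_apply d) hla hb.nx.nx
    have w2 := hn.mono fun z => t.side_of_side_nx hb.nx.nx hna fun h => t.not_side_self a h.nx.nx
    have w3 := t.walk_one_of_not_isLeaf x y (p := t.op a) (q := b)
      (by rw [leftTurn_apply, t.op_op, had]) hlb hb.nx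
    have w4 := hm.mono fun z => t.side_of_side_nx hb.nx hl fun h => t.not_side_self b h.nx
    have w5 := t.walk_one_of_not_isLeaf x y (p := t.op b) (q := t.op d)
      (by rw [leftTurn_apply, t.op_op, ← ha, had]) hl hb
    -- Three turns at the trivalent vertex enclose two excursions, each contributing `y` by
    -- induction; all `y` but one cancel and `x³ = 1` remains.
    have e : x * y * (y * (x * y * (y * (x * y)))) = y := by
      calc _ = x * (y * y) * x * (y * y) * x * y := by simp only [mul_assoc]
        _ = y := by rw [hy, mul_one, mul_one, hx, one_mul]
    exact ⟨_, e ▸ (((w1.trans w2).trans w3).trans w4).trans w5⟩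

theorem leftTurn_op (d : Fin (4 * k + 2)) : t.leftTurn (t.op d) = t.nx (t.nx d) := by
  rw [leftTurn_apply, t.op_op]

/-- The complement of a tree in the sphere has one face: an orbit of `leftTurn` is closed under `op`
by `exists_walk_op`, hence under the rotation too, and the tree is connected. -/
theorem exists_leftTurn_pow_eq (d e : Fin (4 * k + 2)) : ∃ n : ℕ, (t.leftTurn ^ n) d = e := by
  have hop : ∀ x, (∃ n : ℕ, (t.leftTurn ^ n) d = x) → ∃ n : ℕ, (t.leftTurn ^ n) d = t.op x := by
    rintro _ ⟨n, rfl⟩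
    obtain ⟨m, hm⟩ := t.exists_walk_op (P := Unit) (x := 1) (y := 1) rfl rfl ((t.leftTurn ^ n) d)
    exact ⟨m + n, by rw [pow_add, Equiv.Perm.mul_apply, hm.end_eq]⟩
  have hnx : ∀ x, (∃ n : ℕ, (t.leftTurn ^ n) d = x) →
      ∃ n : ℕ, (t.leftTurn ^ n) d = t.nx (t.nx x) := by
    intro x hx
    obtain ⟨m, hm⟩ := hop x hx
    exact ⟨m + 1, by rw [pow_succ', Equiv.Perm.mul_apply, hm, leftTurn_op]⟩
  refine t.induction_of_mem (d := d) ⟨0, rfl⟩ (fun x hx => ?_) hop e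
  have := hnx _ (hnx _ hx)
  rwa [t.nx_nx_nx] at this

theorem isCycleOn_leftTurn :
    t.leftTurn.IsCycleOn (Finset.univ : Finset (Fin (4 * k + 2))) := by
  refine ⟨by simp [Set.bijOn_univ], fun x _ y _ => ?_⟩
  obtain ⟨n, hn⟩ := t.exists_leftTurn_pow_eq x y
  exact ⟨n, by simpa using hn⟩

theorem leftTurn_pow_eq_pow_iff (d : Fin (4 * k + 2)) (m n : ℕ) :
    (t.leftTurn ^ m) d = (t.leftTurn ^ n) d ↔ m ≡ n [MOD 4 * k + 2] := by
  simpa using t.isCycleOn_leftTurn.pow_apply_eq_pow_apply (Finset.mem_univ d) (m := m) (n := n)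

theorem leftTurn_pow_eq_self_iff (d : Fin (4 * k + 2)) (n : ℕ) :
    (t.leftTurn ^ n) d = d ↔ 4 * k + 2 ∣ n := by
  simpa using t.isCycleOn_leftTurn.pow_apply_eq (Finset.mem_univ d) (n := n)

theorem skewTurn_iterate_eq_self {x y : P} (hx : x * x * x = 1) (hy : y * y = 1)
    {v : Fin (4 * k + 2)} (hv : t.IsLeaf v) :
    Function.IsPeriodicPt (t.skewTurn x y) (4 * k + 2) (v, 1) := by
  obtain ⟨n, hn⟩ := t.exists_walk_op hx hy v
  have hl : t.leftTurn (t.op v) = v := by rw [leftTurn_op, hv, hv]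
  have w : (t.skewTurn x y)^[n + 1] (v, 1) = (v, 1) := by
    rw [Function.iterate_succ_apply', hn.1]
    simp [skewTurn, hl, hv, hy]
  have h1 : 4 * k + 2 ∣ n + 1 := by
    rw [← t.leftTurn_pow_eq_self_iff v, pow_succ', Equiv.Perm.mul_apply, hn.end_eq, hl]
  -- A full circuit within these `n` turns would put `v` on its own far side; so `n + 1` is the
  -- period itself and not a larger multiple.
  have h2 : ¬ 4 * k + 2 ≤ n := fun h => by
    have := hn.2 _ (by omega) h
    rw [(t.leftTurn_pow_eq_self_iff v _).2 dvd_rfl] at this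
    exact t.not_side_self v this
  have h3 : n + 1 = 4 * k + 2 := by
    have := Nat.le_of_dvd (by omega) h1
    omega
  have key : ∀ N, n + 1 = N → Function.IsPeriodicPt (t.skewTurn x y) N (v, 1) := by
    rintro _ rfl
    exact w
  exact key _ h3

/-- A tree is simply connected: the relations `X³ = Y² = 1` suffice for the existence of a
potential on the edge ends. -/
theorem exists_potential {x y : P} (hx : x * x * x = 1) (hy : y * y = 1)
    {v : Fin (4 * k + 2)} (hv : t.IsLeaf v) :
    ∃ ψ : Fin (4 * k + 2) → P, ψ v = 1 ∧ (∀ d, ψ (t.op d) = y * ψ d) ∧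
      ∀ d, ¬ t.IsLeaf d → ψ (t.nx⁻¹ d) = x * ψ d := by
  choose n hn using t.exists_leftTurn_pow_eq v
  set ψ : Fin (4 * k + 2) → P := fun d => ((t.skewTurn x y)^[n d] (v, 1)).2 with hψ
  -- The end reached determines the number of turns modulo `4k + 2`, and the product has the same
  -- period, so `ψ` does not depend on the choice of `n`.
  have huniq : ∀ m d p, (t.skewTurn x y)^[m] (v, 1) = (d, p) → ψ d = p := by
    intro m d p h
    have h1 := t.skewTurn_iterate_fst x y m (v, 1)
    rw [h] at h1
    have h2 : m ≡ n d [MOD 4 * k + 2] := by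
      rw [← t.leftTurn_pow_eq_pow_iff v, hn, ← h1]
    have h3 := t.skewTurn_iterate_eq_self hx hy hv
    rw [hψ]
    simp only
    rw [← h3.iterate_mod_apply, ← h2, h3.iterate_mod_apply, h]
  have hspec : ∀ d, (t.skewTurn x y)^[n d] (v, 1) = (d, ψ d) := fun d =>
    Prod.ext (by rw [t.skewTurn_iterate_fst]; exact hn d) rfl
  have hop : ∀ d, ψ (t.op d) = y * ψ d := by
    intro d
    obtain ⟨m, hm⟩ := t.exists_walk_op hx hy d
    refine huniq (m + n d) _ _ ?_
    rw [Function.iterate_add_apply, hspec, hm.1]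
  refine ⟨ψ, huniq 0 v 1 rfl, hop, fun d hd => ?_⟩
  refine huniq (n (t.op d) + 1) _ _ ?_
  have hd' : ¬ t.IsLeaf (t.nx (t.nx d)) := fun h =>
    hd (t.nx.injective (t.nx.injective h))
  rw [Function.iterate_succ_apply', hspec, skewTurn]
  simp only [leftTurn_op, hd', if_false, nx_inv_apply, hop]
  rw [← mul_assoc, mul_assoc x y y, hy, mul_one]

end PlaneTree

/-! ### The elements `XY` and `X²YX⁻¹` -/

namespace ModGroup

/-- The unipotent generator `X Y`. -/
def U : ModGroup := X * Y

/-- The factor `X² Y X⁻¹`. -/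
def A : ModGroup := X ^ 2 * Y * X⁻¹

/-- Arriving at a leaf contributes `Y` instead of `U`. Writing `Y` as `A * U * U` adds one to the
exponent of `U`, which is why the vertex distance, and not the number of edges, appears in the
factorization. -/
theorem A_mul_U_mul_U : A * U * U = Y := by
  calc A * U * U = X ^ 2 * (Y * Y) * X * Y := by simp only [A, U]; group
    _ = X ^ 3 * Y := by rw [Y_mul_Y]; group
    _ = Y := by rw [X_pow_three, one_mul]

/-- The conjugate of `X² Y X⁻¹` by a power of `X Y`. -/
def conjA (a : ℤ) : ModGroup := U ^ a * A * (U ^ a)⁻¹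

theorem conj_conjA (a b : ℤ) : U ^ b * conjA a * (U ^ b)⁻¹ = conjA (b + a) := by
  simp only [conjA, zpow_add]; group

theorem isConj_conjA (a : ℤ) : IsConj (X * Y) (conjA a) := by
  rw [isConj_iff]
  refine ⟨U ^ a * X, ?_⟩
  have hX : X⁻¹ = X ^ 2 := inv_eq_of_mul_eq_one_left (by rw [← pow_succ, X_pow_three])
  simp only [conjA, A, mul_inv_rev, hX, pow_two, mul_assoc]

end ModGroup

namespace PlaneTree

open ModGroup

variable {k : ℕ} (t : PlaneTree k)

/-! ### The cyclic order of the leaves -/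

theorem exists_isLeaf : ∃ v, t.IsLeaf v := by
  have : Nonempty {d // t.nx d = d} := by
    rw [← Nat.card_pos_iff.trans (and_iff_left inferInstance), t.card_leaves]
    omega
  exact ⟨_, this.some.2⟩

theorem pathLength_mem (d : Fin (4 * k + 2)) :
    0 < t.pathLength d ∧ t.IsLeaf ((t.leftTurn ^ t.pathLength d) d) := by
  refine Nat.sInf_mem (s := {j : ℕ | 0 < j ∧ t.IsLeaf ((t.leftTurn ^ j) d)}) ?_
  obtain ⟨v, hv⟩ := t.exists_isLeaf
  obtain ⟨n, hn⟩ := t.exists_leftTurn_pow_eq (t.leftTurn d) v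
  exact ⟨n + 1, by simp, by rwa [pow_succ, Equiv.Perm.mul_apply, hn]⟩

theorem pathLength_pos (d : Fin (4 * k + 2)) : 0 < t.pathLength d := (t.pathLength_mem d).1

theorem isLeaf_nextLeaf (d : Fin (4 * k + 2)) : t.IsLeaf (t.nextLeaf d) := (t.pathLength_mem d).2

theorem pathLength_le {d : Fin (4 * k + 2)} {n : ℕ} (h : 0 < n)
    (hn : t.IsLeaf ((t.leftTurn ^ n) d)) : t.pathLength d ≤ n :=
  Nat.sInf_le ⟨h, hn⟩

theorem isLeaf_iterate {v : Fin (4 * k + 2)} (hv : t.IsLeaf v) (j : ℕ) :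
    t.IsLeaf (t.nextLeaf^[j] v) := by
  cases j with
  | zero => exact hv
  | succ j => rw [Function.iterate_succ_apply']; exact t.isLeaf_nextLeaf _

/-- The number of left turns from `v` to the `j`-th leaf after it. -/
noncomputable def turns (v : Fin (4 * k + 2)) (j : ℕ) : ℕ :=
  ∑ i ∈ Finset.range j, t.pathLength (t.nextLeaf^[i] v)

theorem turns_succ (v : Fin (4 * k + 2)) (j : ℕ) :
    t.turns v (j + 1) = t.turns v j + t.pathLength (t.nextLeaf^[j] v) :=
  Finset.sum_range_succ _ _

theorem turns_strictMono (v : Fin (4 * k + 2)) : StrictMono (t.turns v) :=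
  strictMono_nat_of_lt_succ fun j => by
    rw [turns_succ]; exact Nat.lt_add_of_pos_right (t.pathLength_pos _)

theorem leftTurn_pow_turns (v : Fin (4 * k + 2)) (j : ℕ) :
    (t.leftTurn ^ t.turns v j) v = t.nextLeaf^[j] v := by
  induction j with
  | zero => rfl
  | succ j ih =>
    rw [turns_succ, add_comm (t.turns v j), pow_add, Equiv.Perm.mul_apply, ih, Function.iterate_succ_apply']
    rfl

theorem exists_turns_eq {v : Fin (4 * k + 2)} {n : ℕ} (hn : t.IsLeaf ((t.leftTurn ^ n) v)) :
    ∃ j, t.turns v j = n := by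
  induction n using Nat.strong_induction_on generalizing v with
  | _ n ih =>
  rcases Nat.eq_zero_or_pos n with rfl | h
  · exact ⟨0, rfl⟩
  · obtain ⟨m, rfl⟩ := Nat.exists_eq_add_of_le' (t.pathLength_le h hn)
    rw [pow_add, Equiv.Perm.mul_apply] at hn
    obtain ⟨j, rfl⟩ := ih m (Nat.lt_add_of_pos_right (t.pathLength_pos v)) hn
    exact ⟨j + 1, Finset.sum_range_succ' _ _⟩

theorem exists_turns_lt (v w : Fin (4 * k + 2)) (hw : t.IsLeaf w) :
    ∃ j, t.turns v j < 4 * k + 2 ∧ t.nextLeaf^[j] v = w := by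
  obtain ⟨n, rfl⟩ := t.exists_leftTurn_pow_eq v w
  have h : (t.leftTurn ^ (n % (4 * k + 2))) v = (t.leftTurn ^ n) v :=
    (t.leftTurn_pow_eq_pow_iff v _ _).2 (Nat.mod_modEq _ _)
  rw [← h] at hw
  obtain ⟨j, hj⟩ := t.exists_turns_eq hw
  refine ⟨j, hj ▸ Nat.mod_lt _ (by omega), ?_⟩
  rw [← leftTurn_pow_turns, hj, h]

/-- The first return to `v` takes `4k + 2` turns and meets each leaf once, so it passes through
exactly `k + 2` leaves. -/
theorem turns_eq {v : Fin (4 * k + 2)} (hv : t.IsLeaf v) : t.turns v (k + 2) = 4 * k + 2 := by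
  have hper : (t.leftTurn ^ (4 * k + 2)) v = v := (t.leftTurn_pow_eq_self_iff v _).2 dvd_rfl
  obtain ⟨J, hJ⟩ := t.exists_turns_eq (v := v) (n := 4 * k + 2) (by rwa [hper])
  have hbij : Function.Bijective
      (fun i : Fin J => (⟨t.nextLeaf^[i] v, t.isLeaf_iterate hv i⟩ : {d // t.nx d = d})) := by
    constructor
    · intro i j h
      have h1 : t.nextLeaf^[i] v = t.nextLeaf^[j] v := congrArg Subtype.val h
      rw [← leftTurn_pow_turns, ← leftTurn_pow_turns, leftTurn_pow_eq_pow_iff] at h1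
      have h2 : ∀ i : Fin J, t.turns v i < 4 * k + 2 := fun i =>
        hJ ▸ t.turns_strictMono v i.2
      exact Fin.ext ((t.turns_strictMono v).injective (h1.eq_of_lt_of_lt (h2 i) (h2 j)))
    · rintro ⟨w, hw⟩
      obtain ⟨j, hj, rfl⟩ := t.exists_turns_lt v w hw
      exact ⟨⟨j, (t.turns_strictMono v).lt_iff_lt.1 (by rwa [hJ])⟩, rfl⟩
  have := Nat.card_congr (Equiv.ofBijective _ hbij)
  rw [t.card_leaves, Nat.card_eq_fintype_card, Fintype.card_fin] at this
  rw [← this, hJ]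

theorem iterate_nextLeaf {v : Fin (4 * k + 2)} (hv : t.IsLeaf v) : t.nextLeaf^[k + 2] v = v := by
  rw [← leftTurn_pow_turns, t.turns_eq hv, leftTurn_pow_eq_self_iff]

theorem exists_iterate_eq {v w : Fin (4 * k + 2)} (hv : t.IsLeaf v) (hw : t.IsLeaf w) :
    ∃ j, j < k + 2 ∧ t.nextLeaf^[j] v = w := by
  obtain ⟨j, hj, h⟩ := t.exists_turns_lt v w hw
  exact ⟨j, (t.turns_strictMono v).lt_iff_lt.1 (by rwa [t.turns_eq hv]), h⟩

/-- The sum of the first `j` vertex distances, starting from the leaf `v`. -/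
noncomputable def dist (v : Fin (4 * k + 2)) (j : ℕ) : ℕ :=
  ∑ i ∈ Finset.range j, t.vertexDist (t.nextLeaf^[i] v)

theorem dist_succ (v : Fin (4 * k + 2)) (j : ℕ) :
    t.dist v (j + 1) = t.dist v j + t.vertexDist (t.nextLeaf^[j] v) :=
  Finset.sum_range_succ _ _

theorem dist_succ' (v : Fin (4 * k + 2)) (j : ℕ) :
    t.dist v (j + 1) = t.dist (t.nextLeaf v) j + t.vertexDist v :=
  Finset.sum_range_succ' _ _

theorem dist_eq {v : Fin (4 * k + 2)} (hv : t.IsLeaf v) : t.dist v (k + 2) = 5 * k + 4 := by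
  have h := t.turns_eq hv
  simp only [turns] at h
  simp only [dist, vertexDist, Finset.sum_add_distrib, h, Finset.sum_const, Finset.card_range,
    smul_eq_mul, mul_one]
  ring

/-! ### Potentials -/

/-- A map from the edge ends to a `Γ`-set that intertwines the rotation system with the
action of the generators, except for the rotation at the leaves. -/
structure IsPotential {Z : Type*} [MulAction ModGroup Z] (φ : Fin (4 * k + 2) → Z) : Prop where
  op : ∀ d, φ (t.op d) = Y • φ d
  nx : ∀ d, ¬ t.IsLeaf d → φ (t.nx (t.nx d)) = X • φ d

section

variable {t} {Z : Type*} [MulAction ModGroup Z] {φ : Fin (4 * k + 2) → Z}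

theorem IsPotential.leftTurn_of_not_isLeaf (h : t.IsPotential φ) {d : Fin (4 * k + 2)}
    (hd : ¬ t.IsLeaf (t.leftTurn d)) : φ (t.leftTurn d) = U • φ d := by
  rw [leftTurn_apply] at hd ⊢
  rw [h.nx _ fun h' => hd (by rw [h', h']; exact h'), h.op, U, mul_smul]

theorem IsPotential.leftTurn_of_isLeaf (h : t.IsPotential φ) {d : Fin (4 * k + 2)}
    (hd : t.IsLeaf (t.leftTurn d)) : φ (t.leftTurn d) = Y • φ d := by
  rw [leftTurn_apply] at hd ⊢
  have : t.IsLeaf (t.op d) := t.nx.injective (t.nx.injective hd)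
  rw [this, this, h.op]

theorem IsPotential.leftTurn_pow (h : t.IsPotential φ) {d : Fin (4 * k + 2)} {n : ℕ}
    (hn : n < t.pathLength d) : φ ((t.leftTurn ^ n) d) = U ^ n • φ d := by
  induction n with
  | zero => simp
  | succ n ih =>
    rw [pow_succ', Equiv.Perm.mul_apply, h.leftTurn_of_not_isLeaf, ih (by omega), smul_smul,
      pow_succ']
    intro hl
    rw [← Equiv.Perm.mul_apply, ← pow_succ'] at hl
    exact absurd (t.pathLength_le (by omega) hl) (by omega)

theorem IsPotential.nextLeaf (h : t.IsPotential φ) (d : Fin (4 * k + 2)) :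
    φ (t.nextLeaf d) = (A * U ^ t.vertexDist d) • φ d := by
  obtain ⟨n, hn⟩ := Nat.exists_eq_add_of_lt (t.pathLength_pos d)
  have h1 := t.isLeaf_nextLeaf d
  rw [PlaneTree.nextLeaf, vertexDist, hn, zero_add]
  rw [PlaneTree.nextLeaf, hn, zero_add, pow_succ', Equiv.Perm.mul_apply] at h1
  rw [pow_succ', Equiv.Perm.mul_apply, h.leftTurn_of_isLeaf h1, h.leftTurn_pow (by omega),
    smul_smul, ← A_mul_U_mul_U]
  simp only [pow_succ', mul_assoc]

end

theorem exists_isPotential {v : Fin (4 * k + 2)} (hv : t.IsLeaf v) :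
    ∃ ψ : Fin (4 * k + 2) → ModGroup, ψ v = 1 ∧ t.IsPotential ψ := by
  obtain ⟨ψ, h1, h2, h3⟩ := t.exists_potential X_mul_X_mul_X Y_mul_Y hv
  exact ⟨ψ, h1, h2, fun d hd => by rw [← nx_inv_apply, h3 d hd, smul_eq_mul]⟩

/-! ### The factorizations -/

theorem factorization_eq (v : Fin (4 * k + 2)) (s : ℤ) :
    t.factorization v s =
      (List.range (k + 2)).map fun i => conjA (s + t.dist v (k + 1) - t.dist v i) := by
  rw [factorization, baseFactorization, List.map_map]
  refine List.map_congr_left fun i hi => ?_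
  have hi' : i ≤ k + 1 := by have := List.mem_range.1 hi; omega
  have h : t.dist v (k + 1) = t.dist v i + t.distToLast v i := by
    rw [dist, dist, distToLast, Finset.sum_range_add_sum_Ico _ hi']
  have h2 : s + (t.dist v (k + 1) : ℤ) - t.dist v i = s + (t.distToLast v i : ℤ) := by
    rw [h]; push_cast; ring
  rw [h2, ← conj_conjA, conjA, zpow_natCast]
  rfl

theorem isSimple_factorization (v : Fin (4 * k + 2)) (s : ℤ) :
    BM.IsSimple (t.factorization v s) := by
  intro m hm
  rw [factorization_eq, List.mem_map] at hm
  obtain ⟨i, -, rfl⟩ := hm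
  exact isConj_conjA _

theorem atInfinity_factorization {v : Fin (4 * k + 2)} (hv : t.IsLeaf v) (s : ℤ) :
    BM.atInfinity (t.factorization v s) = U ^ (-(5 * (k : ℤ)) - 4) := by
  obtain ⟨ψ, h1, h2⟩ := t.exists_isPotential hv
  -- The product telescopes along the leaves by `IsPotential.nextLeaf`. For `j = k + 2` the walk is
  -- back at `v`, where the potential is `1`, and only the total distance `5k + 4` survives.
  have key : ∀ j, ∀ a : ℤ, BM.atInfinity ((List.range j).map fun i => conjA (a - t.dist v i)) =
      U ^ (a - t.dist v j) * A⁻¹ * ψ (t.nextLeaf^[j] v) * A * (U ^ a)⁻¹ := by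
    intro j a
    induction j with
    | zero => simp [BM.atInfinity, dist, h1]
    | succ j ih =>
      have e : BM.atInfinity ((List.range (j + 1)).map fun i => conjA (a - t.dist v i)) =
          conjA (a - t.dist v j) *
            BM.atInfinity ((List.range j).map fun i => conjA (a - t.dist v i)) := by
        simp [BM.atInfinity, List.range_succ]
      rw [e, ih, Function.iterate_succ_apply', h2.nextLeaf, dist_succ, smul_eq_mul, conjA,
        show U ^ (a - t.dist v j) = U ^ (a - ((t.dist v j +
          t.vertexDist (t.nextLeaf^[j] v) : ℕ) : ℤ)) *
          U ^ t.vertexDist (t.nextLeaf^[j] v) by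
        rw [← zpow_natCast, ← zpow_add]; congr 1; push_cast; ring]
      group
  rw [factorization_eq, key, t.iterate_nextLeaf hv, h1, t.dist_eq hv, mul_one,
    inv_mul_cancel_right, ← zpow_neg, ← zpow_add]
  congr 1
  push_cast
  ring

end PlaneTree

/-! ### Rotating a factorization and changing the first leaf -/

namespace BM

variable {G : Type*} [Group G]

theorem StrongEquiv.cons {l l' : List G} (h : StrongEquiv l l') (a : G) :
    StrongEquiv (a :: l) (a :: l') := by
  induction h with
  | rel _ _ h =>
    obtain ⟨l₁, b, c, l₂⟩ := h
    exact .rel _ _ (HurwitzMove.move (a :: l₁) b c l₂)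
  | refl _ => exact .refl _
  | symm _ _ _ ih => exact ih.symm
  | trans _ _ _ _ _ ih ih' => exact ih.trans _ _ _ ih'

/-- Moving the first entry of a factorization to the end. -/
theorem strongEquiv_rotate (a : G) (l : List G) :
    StrongEquiv (a :: l) (l ++ [atInfinity (a :: l) * a * (atInfinity (a :: l))⁻¹]) := by
  induction l generalizing a with
  | nil => simpa [atInfinity, StrongEquiv] using Relation.EqvGen.refl [a]
  | cons b l ih =>
    -- An inverse Hurwitz move carries `a` past `b`.
    have h1 : StrongEquiv (a :: b :: l) (b :: b * a * b⁻¹ :: l) := by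
      have := HurwitzMove.move [] b (b * a * b⁻¹) l
      rw [show b⁻¹ * (b * a * b⁻¹) * b = a by group] at this
      exact (Relation.EqvGen.rel _ _ this).symm
    refine h1.trans _ _ _ ?_
    have h2 := (ih (b * a * b⁻¹)).cons b
    have h3 : atInfinity (b * a * b⁻¹ :: l) * (b * a * b⁻¹) * (atInfinity (b * a * b⁻¹ :: l))⁻¹ =
        atInfinity (a :: b :: l) * a * (atInfinity (a :: b :: l))⁻¹ := by
      simp only [atInfinity, List.reverse_cons, List.prod_append, List.prod_singleton]
      group
    rwa [h3] at h2

end BM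

namespace PlaneTree

open ModGroup

variable {k : ℕ} (t : PlaneTree k)

/-- The first entry goes to the end, conjugated by the monodromy at infinity `U^(-5k-4)`. Since the
vertex distances around the tree add up to `5k + 4`, the new exponents are those of the next
marking. Here `w` is the last leaf in the numbering from `v`, so that `U ^ s • w` is the base point
and stays the same. -/
theorem strongEquiv_nextLeaf {w : Fin (4 * k + 2)} (hw : t.IsLeaf w) (s : ℤ) :
    BM.StrongEquiv (t.factorization (t.nextLeaf w) s)
      (t.factorization (t.nextLeaf (t.nextLeaf w)) (s - t.vertexDist w)) := by
  set v := t.nextLeaf w with hv'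
  have hv : t.IsLeaf v := t.isLeaf_nextLeaf w
  have hlast : t.nextLeaf^[k + 1] v = w := by
    rw [hv', ← Function.iterate_succ_apply, t.iterate_nextLeaf hw]
  have h1 := t.atInfinity_factorization hv s
  have h2 := t.dist_succ v (k + 1)
  rw [t.dist_eq hv, hlast] at h2
  have e1 : t.factorization v s = conjA (s + t.dist v (k + 1)) ::
      (List.range (k + 1)).map fun i => conjA (s + t.dist v (k + 1) - t.dist v (i + 1)) := by
    rw [factorization_eq, List.range_succ_eq_map, List.map_cons, List.map_map]
    congr 2
    simp [dist]
  have e2 : t.factorization (t.nextLeaf v) (s - t.vertexDist w) =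
      ((List.range (k + 1)).map fun i => conjA (s + t.dist v (k + 1) - t.dist v (i + 1))) ++
        [U ^ (-(5 * (k : ℤ)) - 4) * conjA (s + t.dist v (k + 1)) *
          (U ^ (-(5 * (k : ℤ)) - 4))⁻¹] := by
    have h3 : ∀ i, s - (t.vertexDist w : ℤ) + t.dist (t.nextLeaf v) (k + 1) -
        t.dist (t.nextLeaf v) i = s + t.dist v (k + 1) - t.dist v (i + 1) := by
      intro i
      have h4 := t.dist_succ' v (k + 1)
      have h5 := t.dist_succ' v i
      rw [t.dist_eq hv] at h4
      omega
    rw [factorization_eq, List.range_succ, List.map_append, conj_conjA]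
    simp only [h3, List.map_cons, List.map_nil]
    rw [t.dist_eq hv]
    congr 3
    push_cast
    ring
  have := BM.strongEquiv_rotate (conjA (s + t.dist v (k + 1)))
    ((List.range (k + 1)).map fun i => conjA (s + t.dist v (k + 1) - t.dist v (i + 1)))
  rwa [← e1, h1, ← e2] at this

end PlaneTree

/-! ### Transitive actions and the trivalent graph with loops -/

/-- Transitive actions with equal point stabilizers are isomorphic. -/
theorem MulAction.exists_equiv_of_stabilizer_eq {G Z Z' : Type*} [Group G] [MulAction G Z]
    [MulAction G Z'] [MulAction.IsPretransitive G Z] [MulAction.IsPretransitive G Z']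
    {z : Z} {z' : Z'} (h : MulAction.stabilizer G z = MulAction.stabilizer G z') :
    ∃ f : Z ≃ Z', f z = z' ∧ ∀ (g : G) (ω : Z), f (g • ω) = g • f ω := by
  choose γ hγ using MulAction.exists_smul_eq G z
  have key : ∀ g g' : G, g • z = g' • z ↔ g • z' = g' • z' := by
    intro g g'
    have := SetLike.ext_iff.1 h (g'⁻¹ * g)
    simpa only [MulAction.mem_stabilizer_iff, mul_smul, inv_smul_eq_iff] using this
  have hf : ∀ g : G, γ (g • z) • z' = g • z' := fun g => (key _ _).1 (hγ _)
  refine ⟨Equiv.ofBijective (fun ω => γ ω • z') ⟨fun ω ω' h => ?_, fun ω' => ?_⟩, ?_, fun g ω => ?_⟩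
  · rw [← hγ ω, ← hγ ω']; exact (key _ _).2 h
  · obtain ⟨g, rfl⟩ := MulAction.exists_smul_eq G z' ω'
    exact ⟨g • z, hf g⟩
  · change γ z • z' = z'
    simpa using hf 1
  · change γ (g • ω) • z' = g • γ ω • z'
    rw [← mul_smul, ← hf (g * γ ω), mul_smul, hγ]

namespace PlaneTree

open ModGroup

variable {k : ℕ} (t : PlaneTree k)

/-- The edge ends of the trivalent graph obtained from a plane tree by attaching a loop at each
leaf. -/
inductive Dessin : Type
  | ofEnd (d : Fin (4 * k + 2))
  | loop (d : Fin (4 * k + 2)) (hd : t.IsLeaf d) (b : Bool)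

namespace Dessin

variable {t}

/-- The other end of the same edge. -/
def flip : t.Dessin → t.Dessin
  | ofEnd d => ofEnd (t.op d)
  | loop d hd b => loop d hd (!b)

open Classical in
/-- The next edge end, clockwise, at the same vertex. -/
noncomputable def rotate : t.Dessin → t.Dessin
  | ofEnd d => if hd : t.IsLeaf d then loop d hd false else ofEnd (t.nx (t.nx d))
  | loop d hd false => loop d hd true
  | loop d _ true => ofEnd d

theorem flip_flip (ω : t.Dessin) : ω.flip.flip = ω := by
  cases ω <;> simp [flip, t.op_op]

theorem rotate_ofEnd_of_isLeaf {d : Fin (4 * k + 2)} (hd : t.IsLeaf d) :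
    (ofEnd d : t.Dessin).rotate = loop d hd false := dif_pos hd

theorem rotate_ofEnd {d : Fin (4 * k + 2)} (hd : ¬ t.IsLeaf d) :
    (ofEnd d : t.Dessin).rotate = ofEnd (t.nx (t.nx d)) := dif_neg hd

theorem rotate_rotate_rotate (ω : t.Dessin) : ω.rotate.rotate.rotate = ω := by
  match ω with
  | ofEnd d =>
    by_cases hd : t.IsLeaf d
    · rw [rotate_ofEnd_of_isLeaf hd]; rfl
    · have h1 : ¬ t.IsLeaf (t.nx (t.nx d)) := fun h => hd (t.nx.injective (t.nx.injective h))
      have h2 : ¬ t.IsLeaf (t.nx d) := fun h => hd (t.nx.injective h)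
      rw [rotate_ofEnd hd, rotate_ofEnd h1, t.nx_nx_nx, rotate_ofEnd h2, t.nx_nx_nx]
  | loop d hd false => exact rotate_ofEnd_of_isLeaf hd
  | loop d hd true => exact congrArg rotate (rotate_ofEnd_of_isLeaf hd)

/-- `flip` as a permutation. -/
def flipPerm : Equiv.Perm t.Dessin := ⟨flip, flip, flip_flip, flip_flip⟩

/-- `rotate` as a permutation. -/
noncomputable def rotatePerm : Equiv.Perm t.Dessin :=
  ⟨rotate, fun ω => ω.rotate.rotate, rotate_rotate_rotate, rotate_rotate_rotate⟩

theorem exists_hom : ∃ ρ : ModGroup →* Equiv.Perm t.Dessin, ρ X = rotatePerm ∧ ρ Y = flipPerm :=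
  exists_lift _ _ (Equiv.ext rotate_rotate_rotate) (Equiv.ext flip_flip)

noncomputable instance : MulAction ModGroup t.Dessin :=
  MulAction.compHom t.Dessin (exists_hom (t := t)).choose

theorem X_smul (ω : t.Dessin) : X • ω = ω.rotate :=
  Equiv.congr_fun (exists_hom (t := t)).choose_spec.1 ω

theorem Y_smul (ω : t.Dessin) : Y • ω = ω.flip :=
  Equiv.congr_fun (exists_hom (t := t)).choose_spec.2 ω

theorem isPotential_ofEnd : t.IsPotential (ofEnd : _ → t.Dessin) :=
  ⟨fun d => (Y_smul (ofEnd d)).symm, fun _ hd => by rw [X_smul, rotate_ofEnd hd]⟩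

theorem A_smul {d : Fin (4 * k + 2)} (hd : t.IsLeaf d) :
    A • (ofEnd d : t.Dessin) = ofEnd d := by
  have hX : X⁻¹ = X * X := inv_eq_of_mul_eq_one_left X_mul_X_mul_X
  simp only [A, hX, pow_two, mul_smul, X_smul, Y_smul, rotate_ofEnd_of_isLeaf hd]
  rfl

theorem U_pow_vertexDist_smul (d : Fin (4 * k + 2)) :
    U ^ t.vertexDist d • (ofEnd d : t.Dessin) = ofEnd (t.nextLeaf d) := by
  have h := (isPotential_ofEnd (t := t)).nextLeaf d
  rw [mul_smul, ← A_smul (t.isLeaf_nextLeaf d)] at h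
  exact (smul_left_cancel A h).symm

theorem U_pow_dist_smul (d : Fin (4 * k + 2)) (j : ℕ) :
    U ^ t.dist d j • (ofEnd d : t.Dessin) = ofEnd (t.nextLeaf^[j] d) := by
  induction j with
  | zero => simp [dist]
  | succ j ih =>
    rw [dist_succ, add_comm, pow_add, mul_smul, ih, U_pow_vertexDist_smul,
      Function.iterate_succ_apply']

instance : MulAction.IsPretransitive ModGroup t.Dessin := by
  obtain ⟨v, -⟩ := t.exists_isLeaf
  have h1 : ∀ d, ∃ g : ModGroup, g • (ofEnd v : t.Dessin) = ofEnd d := by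
    refine t.induction_of_mem (d := v) ⟨1, one_smul _ _⟩ ?_ ?_
    · rintro x ⟨g, hg⟩
      by_cases hx : t.IsLeaf x
      · exact ⟨g, by rw [hg, hx]⟩
      · have hx' : ¬ t.IsLeaf (t.nx (t.nx x)) := fun h => hx (t.nx.injective (t.nx.injective h))
        refine ⟨X * X * g, ?_⟩
        rw [mul_smul, hg, mul_smul, X_smul, X_smul, rotate_ofEnd hx, rotate_ofEnd hx', t.nx_nx_nx]
    · rintro x ⟨g, hg⟩
      exact ⟨Y * g, by rw [mul_smul, hg, Y_smul]; rfl⟩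
  rw [MulAction.isPretransitive_iff_base (ofEnd v : t.Dessin)]
  intro ω
  match ω with
  | ofEnd d => exact h1 d
  | loop d hd false =>
    obtain ⟨g, hg⟩ := h1 d
    exact ⟨X * g, by rw [mul_smul, hg, X_smul, rotate_ofEnd_of_isLeaf hd]⟩
  | loop d hd true =>
    obtain ⟨g, hg⟩ := h1 d
    exact ⟨X * (X * g), by 
      rw [mul_smul, mul_smul, hg, X_smul (ofEnd d), rotate_ofEnd_of_isLeaf hd, X_smul]; rfl⟩

/-- The edge ends of the trivalent graph: those of the tree and those of the loops. -/
def equivSum : t.Dessin ≃ Fin (4 * k + 2) ⊕ {d // t.nx d = d} × Bool where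
  toFun
    | ofEnd d => .inl d
    | loop d hd b => .inr (⟨d, hd⟩, b)
  invFun
    | .inl d => ofEnd d
    | .inr (d, b) => loop d.1 d.2 b
  left_inv ω := by cases ω <;> rfl
  right_inv ω := by rcases ω with _ | ⟨_, _⟩ <;> rfl

theorem card_eq : Nat.card t.Dessin = 6 * (k + 1) := by
  rw [Nat.card_congr equivSum, Nat.card_sum, Nat.card_prod, t.card_leaves]
  simp
  ring

/-- A potential whose values at the leaves are fixed by `X² Y X⁻¹` extends to the trivalent
graph. -/
theorem exists_extension {Z : Type*} [MulAction ModGroup Z] {φ : Fin (4 * k + 2) → Z}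
    (hφ : t.IsPotential φ) (hA : ∀ d, t.IsLeaf d → A • φ d = φ d) :
    ∃ Φ : t.Dessin → Z, (∀ d, Φ (ofEnd d) = φ d) ∧
      ∀ (g : ModGroup) (ω : t.Dessin), Φ (g • ω) = g • Φ ω := by
  let Φ : t.Dessin → Z
    | ofEnd d => φ d
    | loop d _ false => X • φ d
    | loop d _ true => X • X • φ d
  have hX3 : ∀ z : Z, X • X • X • z = z := fun z => by
    rw [smul_smul, smul_smul, X_mul_X_mul_X, one_smul]
  have hY2 : ∀ z : Z, Y • Y • z = z := fun z => by rw [smul_smul, Y_mul_Y, one_smul]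
  have hXΦ : ∀ ω, Φ (X • ω) = X • Φ ω := by
    intro ω
    rw [X_smul]
    match ω with
    | ofEnd d =>
      by_cases hd : t.IsLeaf d
      · rw [rotate_ofEnd_of_isLeaf hd]
      · rw [rotate_ofEnd hd]; exact hφ.nx d hd
    | loop d hd false => rfl
    | loop d hd true => exact (hX3 _).symm
  -- Being fixed by `A` is exactly the condition that `Y` exchanges the two prospective images of
  -- the loop ends.
  have hYX : ∀ d, t.IsLeaf d → Y • X • X • φ d = X • φ d := by
    intro d hd
    have h := hA d hd
    have hX : X⁻¹ = X * X := inv_eq_of_mul_eq_one_left X_mul_X_mul_X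
    simp only [A, hX, pow_two, mul_smul] at h
    rw [← hX3 (Y • X • X • φ d), h]
  have hYΦ : ∀ ω, Φ (Y • ω) = Y • Φ ω := by
    intro ω
    rw [Y_smul]
    match ω with
    | ofEnd d => exact hφ.op d
    | loop d hd false =>
      change X • X • φ d = Y • X • φ d
      exact ((congrArg (Y • ·) (hYX d hd)).symm.trans (hY2 _)).symm
    | loop d hd true => exact (hYX d hd).symm
  refine ⟨Φ, fun _ => rfl, fun g => ?_⟩
  have hg : g ∈ Subgroup.closure {X, Y} := closure_X_Y ▸ Subgroup.mem_top g
  induction hg using Subgroup.closure_induction with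
  | mem g hg =>
    rcases hg with rfl | rfl
    · exact hXΦ
    · exact hYΦ
  | one => simp
  | mul g g' _ _ h h' => intro ω; rw [mul_smul, h, h', mul_smul]
  | inv g _ h => intro ω; rw [eq_inv_smul_iff, ← h, smul_inv_smul]

end Dessin

theorem conjA_mem_monodromyGroup (v : Fin (4 * k + 2)) (s : ℤ) {i : ℕ} (hi : i < k + 2) :
    conjA (s + t.dist v (k + 1) - t.dist v i) ∈ BM.monodromyGroup (t.factorization v s) := by
  refine Subgroup.subset_closure ?_
  change _ ∈ t.factorization v s
  rw [factorization_eq]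
  exact List.mem_map_of_mem (List.mem_range.2 hi)

/-- The monodromy group is the stabilizer of a point of the dessin. -/
theorem monodromyGroup_eq_stabilizer {w : Fin (4 * k + 2)} (hw : t.IsLeaf w) (s : ℤ) :
    BM.monodromyGroup (t.factorization (t.nextLeaf w) s) =
      MulAction.stabilizer ModGroup (U ^ s • (Dessin.ofEnd w : t.Dessin)) := by
  set v := t.nextLeaf w with hv'
  have hv : t.IsLeaf v := t.isLeaf_nextLeaf w
  have hlast : t.nextLeaf^[k + 1] v = w := by
    rw [hv', ← Function.iterate_succ_apply, t.iterate_nextLeaf hw]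
  set a : ℤ := s + t.dist v (k + 1) with ha
  have hpt : U ^ s • (Dessin.ofEnd w : t.Dessin) = U ^ a • Dessin.ofEnd v := by
    rw [ha, zpow_add, mul_smul, zpow_natCast, Dessin.U_pow_dist_smul, hlast]
  apply le_antisymm
  · rw [hpt, BM.monodromyGroup, Subgroup.closure_le]
    intro m hm
    change m ∈ t.factorization v s at hm
    rw [factorization_eq, List.mem_map] at hm
    obtain ⟨i, -, rfl⟩ := hm
    have h1 : (U ^ (a - t.dist v i))⁻¹ • U ^ a • (Dessin.ofEnd v : t.Dessin) =
        Dessin.ofEnd (t.nextLeaf^[i] v) := by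
      rw [smul_smul, ← Dessin.U_pow_dist_smul, ← zpow_natCast]
      congr 1
      group
    rw [SetLike.mem_coe, MulAction.mem_stabilizer_iff, conjA, mul_smul, h1, mul_smul,
      Dessin.A_smul (t.isLeaf_iterate hv i), ← h1, smul_inv_smul]
  · set H := BM.monodromyGroup (t.factorization v s) with hH
    obtain ⟨ψ, h1, h2⟩ := t.exists_isPotential hv
    -- In terms of the entries `m_i`, these elements are the products `m_{j+1} ⋯ m_2`.
    have hmem : ∀ j, j < k + 2 →
        U ^ (a - t.dist v j) * (ψ (t.nextLeaf^[j] v) * U ^ (-a)) ∈ H := by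
      intro j
      induction j with
      | zero => intro; simp [dist, h1]
      | succ j ih =>
        intro hj
        have h3 := mul_mem (t.conjA_mem_monodromyGroup v s hj) (ih (by omega))
        rw [Function.iterate_succ_apply', h2.nextLeaf]
        convert h3 using 1
        rw [← ha, conjA, dist_succ, smul_eq_mul,
          show U ^ (a - t.dist v j) = U ^ (a - ((t.dist v j +
            t.vertexDist (t.nextLeaf^[j] v) : ℕ) : ℤ)) *
            U ^ t.vertexDist (t.nextLeaf^[j] v) by
          rw [← zpow_natCast, ← zpow_add]; congr 1; push_cast; ring]
        group
    have hφ : t.IsPotential fun d => (QuotientGroup.mk (ψ d * U ^ (-a)) : ModGroup ⧸ H) :=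
      ⟨fun d => by rw [h2.op, smul_eq_mul, mul_assoc]; rfl,
        fun d hd => by rw [h2.nx d hd, smul_eq_mul, mul_assoc]; rfl⟩
    -- Conjugating the entry at the leaf by the element from `hmem` shows that `A` fixes the coset
    -- at this leaf.
    have hA : ∀ d, t.IsLeaf d → A • (QuotientGroup.mk (ψ d * U ^ (-a)) : ModGroup ⧸ H) =
        QuotientGroup.mk (ψ d * U ^ (-a)) := by
      intro d hd
      obtain ⟨j, hj, rfl⟩ := t.exists_iterate_eq hv hd
      change (QuotientGroup.mk (A * _) : ModGroup ⧸ H) = _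
      rw [eq_comm, QuotientGroup.eq]
      have h3 := hmem j hj
      have h4 := mul_mem (mul_mem (inv_mem h3) (t.conjA_mem_monodromyGroup v s hj)) h3
      rw [← ha, conjA] at h4
      convert h4 using 1
      group
    obtain ⟨Φ, hΦ, hΦ'⟩ := Dessin.exists_extension hφ hA
    have hbase : Φ (U ^ s • Dessin.ofEnd w) = (QuotientGroup.mk 1 : ModGroup ⧸ H) := by
      rw [hΦ', hΦ]
      change (QuotientGroup.mk (U ^ s * _) : ModGroup ⧸ H) = _
      rw [eq_comm, QuotientGroup.eq, inv_one, one_mul]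
      have h3 := hmem (k + 1) (by omega)
      rwa [hlast, show a - (t.dist v (k + 1) : ℤ) = s by rw [ha]; ring] at h3
    -- What fixes the base point of the dessin fixes its image, the trivial coset.
    intro g hg
    rw [MulAction.mem_stabilizer_iff] at hg
    have h3 := hΦ' g (U ^ s • Dessin.ofEnd w)
    rw [hg, hbase] at h3
    change _ = (QuotientGroup.mk (g * 1) : ModGroup ⧸ H) at h3
    rwa [QuotientGroup.eq, inv_one, one_mul, mul_one] at h3

/-! ### Isotopies -/

/-- Equivariant bijections of dessins come from isotopies. -/
theorem exists_isotopy {t t' : PlaneTree k} (f : t.Dessin ≃ t'.Dessin)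
    (hf : ∀ (g : ModGroup) (ω : t.Dessin), f (g • ω) = g • f ω) :
    ∃ e : Equiv.Perm (Fin (4 * k + 2)), (∀ d, f (.ofEnd d) = .ofEnd (e d)) ∧
      (∀ d, e (t.op d) = t'.op (e d)) ∧ ∀ d, e (t.nx d) = t'.nx (e d) := by
  -- A property stated through the action alone that separates loop ends from tree ends; `hend`
  -- holds because no edge of a tree joins a vertex to itself.
  have hloop : ∀ (t : PlaneTree k) (d : Fin (4 * k + 2)) (hd : t.IsLeaf d) (b : Bool),
      Y • (Dessin.loop d hd b : t.Dessin) = X • Dessin.loop d hd b ∨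
        X • Y • (Dessin.loop d hd b : t.Dessin) = Dessin.loop d hd b := by
    rintro t d hd (_ | _)
    · left; rw [Dessin.X_smul, Dessin.Y_smul]; rfl
    · right; rw [Dessin.X_smul, Dessin.Y_smul]; rfl
  have hend : ∀ (t : PlaneTree k) (d : Fin (4 * k + 2)),
      ¬ (Y • (Dessin.ofEnd d : t.Dessin) = X • Dessin.ofEnd d ∨
        X • Y • (Dessin.ofEnd d : t.Dessin) = Dessin.ofEnd d) := by
    intro t d
    rw [Dessin.X_smul, Dessin.Y_smul, Dessin.X_smul, not_or]
    constructor
    · intro h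
      by_cases hd : t.IsLeaf d
      · rw [Dessin.rotate_ofEnd_of_isLeaf hd] at h; cases h
      · rw [Dessin.rotate_ofEnd hd] at h
        have h' : t.op d = t.nx (t.nx d) := Dessin.ofEnd.inj h
        exact t.nx_op_ne d (by rw [h', t.nx_nx_nx])
    · intro h
      change (Dessin.ofEnd (t.op d) : t.Dessin).rotate = _ at h
      by_cases hd : t.IsLeaf (t.op d)
      · rw [Dessin.rotate_ofEnd_of_isLeaf hd] at h; cases h
      · rw [Dessin.rotate_ofEnd hd] at h
        exact t.nx_nx_op_ne d (Dessin.ofEnd.inj h)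
  have hex : ∀ d, ∃ d', f (.ofEnd d) = .ofEnd d' := by
    intro d
    match h : f (.ofEnd d) with
    | .ofEnd d' => exact ⟨d', rfl⟩
    | .loop d' hd' b =>
      have h1 := hloop t' d' hd' b
      rw [← h, ← hf, ← hf, ← hf, f.apply_eq_iff_eq, f.apply_eq_iff_eq] at h1
      exact absurd h1 (hend t d)
  choose e he using hex
  have hinj : Function.Injective e := fun d d' h =>
    Dessin.ofEnd.inj (f.injective (by rw [he, he, h]))
  have hop : ∀ d, e (t.op d) = t'.op (e d) := by
    intro d
    have h := hf Y (.ofEnd d)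
    rw [he, Dessin.Y_smul, Dessin.Y_smul] at h
    exact Dessin.ofEnd.inj ((he _).symm.trans h)
  have hnx2 : ∀ d, e (t.nx (t.nx d)) = t'.nx (t'.nx (e d)) := by
    intro d
    have h := hf X (.ofEnd d)
    rw [he, Dessin.X_smul, Dessin.X_smul] at h
    by_cases hd : t.IsLeaf d <;> by_cases hd' : t'.IsLeaf (e d)
    · rw [hd, hd, hd', hd']
    · rw [Dessin.rotate_ofEnd_of_isLeaf hd, Dessin.rotate_ofEnd hd', ← Equiv.eq_symm_apply] at h
      have h1 := hloop t d hd false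
      rw [← f.apply_eq_iff_eq, ← f.apply_eq_iff_eq, hf, hf, hf, hf, h, f.apply_symm_apply] at h1
      exact absurd h1 (hend t' _)
    · rw [Dessin.rotate_ofEnd_of_isLeaf hd', Dessin.rotate_ofEnd hd, he] at h
      cases h
    · rw [Dessin.rotate_ofEnd hd', Dessin.rotate_ofEnd hd, he] at h
      exact Dessin.ofEnd.inj h
  refine ⟨Equiv.ofBijective e (Finite.injective_iff_bijective.1 hinj), he, hop, fun d => ?_⟩
  change e (t.nx d) = t'.nx (e d)
  rw [← t.nx_nx_nx d, hnx2, t.nx_nx_nx, hnx2, t'.nx_nx_nx]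

variable {t} in
/-- Isotopies preserve the factorizations. -/
theorem factorization_eq_of_isotopy {t' : PlaneTree k} {e : Equiv.Perm (Fin (4 * k + 2))}
    (h1 : ∀ d, e (t.op d) = t'.op (e d)) (h2 : ∀ d, e (t.nx d) = t'.nx (e d)) :
    (∀ d, t'.IsLeaf (e d) ↔ t.IsLeaf d) ∧ (∀ d, t'.nextLeaf (e d) = e (t.nextLeaf d)) ∧
      ∀ v s, t'.factorization (e v) s = t.factorization v s := by
  have hleaf : ∀ d, t'.IsLeaf (e d) ↔ t.IsLeaf d := fun d => by
    rw [IsLeaf, IsLeaf, ← h2, e.apply_eq_iff_eq]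
  have hturn : ∀ n d, (t'.leftTurn ^ n) (e d) = e ((t.leftTurn ^ n) d) := by
    intro n d
    induction n with
    | zero => rfl
    | succ n ih =>
      rw [pow_succ', pow_succ', Equiv.Perm.mul_apply, Equiv.Perm.mul_apply, ih, leftTurn_apply,
        leftTurn_apply, h2, h2, h1]
  have hlen : ∀ d, t'.pathLength (e d) = t.pathLength d := fun d => by
    simp only [pathLength, hturn, hleaf]
  have hnext : ∀ d, t'.nextLeaf (e d) = e (t.nextLeaf d) := fun d => by
    rw [nextLeaf, hlen, hturn, nextLeaf]
  have hiter : ∀ j d, t'.nextLeaf^[j] (e d) = e (t.nextLeaf^[j] d) := by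
    intro j d
    induction j with
    | zero => rfl
    | succ j ih => rw [Function.iterate_succ_apply', ih, hnext, Function.iterate_succ_apply']
  refine ⟨hleaf, hnext, fun v s => ?_⟩
  have hdist : ∀ j, t'.dist (e v) j = t.dist v j := fun j => by
    simp only [dist, vertexDist, hiter, hlen]
  simp only [factorization_eq, hdist]

end PlaneTree

/-! ### Invariance of the monodromy group -/

namespace BM

variable {G : Type*} [Group G]

theorem StrongEquiv.weakEquiv {l l' : List G} (h : StrongEquiv l l') : WeakEquiv l l' :=
  Relation.EqvGen.mono (fun _ _ => Or.inl) _ _ h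

theorem weakEquiv_of_isGlobalConj {l l' : List G} (h : IsGlobalConj l l') : WeakEquiv l l' :=
  .rel _ _ (Or.inr h)

theorem HurwitzMove.monodromyGroup_eq {l l' : List G} (h : HurwitzMove l l') :
    monodromyGroup l = monodromyGroup l' := by
  obtain ⟨l₁, a, b, l₂⟩ := h
  apply le_antisymm
  · have hmem : ∀ m ∈ l₁ ++ (a⁻¹ * b * a) :: a :: l₂,
        m ∈ monodromyGroup (l₁ ++ (a⁻¹ * b * a) :: a :: l₂) :=
      fun m hm => Subgroup.subset_closure hm
    refine (Subgroup.closure_le _).2 fun m hm => ?_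
    change m ∈ l₁ ++ a :: b :: l₂ at hm
    have ha := hmem a (by simp)
    have hb : b ∈ monodromyGroup (l₁ ++ (a⁻¹ * b * a) :: a :: l₂) := by
      have := mul_mem (mul_mem ha (hmem (a⁻¹ * b * a) (by simp))) (inv_mem ha)
      rwa [show a * (a⁻¹ * b * a) * a⁻¹ = b by group] at this
    simp only [List.mem_append, List.mem_cons] at hm
    rcases hm with hm | rfl | rfl | hm
    · exact hmem m (by simp [hm])
    · exact ha
    · exact hb
    · exact hmem m (by simp [hm])
  · have hmem : ∀ m ∈ l₁ ++ a :: b :: l₂, m ∈ monodromyGroup (l₁ ++ a :: b :: l₂) :=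
      fun m hm => Subgroup.subset_closure hm
    refine (Subgroup.closure_le _).2 fun m hm => ?_
    change m ∈ l₁ ++ (a⁻¹ * b * a) :: a :: l₂ at hm
    have ha := hmem a (by simp)
    simp only [List.mem_append, List.mem_cons] at hm
    rcases hm with hm | rfl | rfl | hm
    · exact hmem m (by simp [hm])
    · exact mul_mem (mul_mem (inv_mem ha) (hmem b (by simp))) ha
    · exact ha
    · exact hmem m (by simp [hm])

theorem StrongEquiv.monodromyGroup_eq {l l' : List G} (h : StrongEquiv l l') :
    monodromyGroup l = monodromyGroup l' := by
  induction h with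
  | rel _ _ h => exact h.monodromyGroup_eq
  | refl _ => rfl
  | symm _ _ _ ih => exact ih.symm
  | trans _ _ _ _ _ ih ih' => exact ih.trans ih'

theorem ConjSubgroups.of_eq {H H' : Subgroup G} (h : H = H') : ConjSubgroups H H' :=
  ⟨1, by subst h; ext; simp⟩

theorem ConjSubgroups.symm {H H' : Subgroup G} (h : ConjSubgroups H H') : ConjSubgroups H' H := by
  obtain ⟨g, rfl⟩ := h
  refine ⟨g⁻¹, ?_⟩
  rw [Subgroup.map_map]
  ext x
  simp [Subgroup.mem_map, mul_assoc]

theorem ConjSubgroups.trans {H H' H'' : Subgroup G} (h : ConjSubgroups H H')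
    (h' : ConjSubgroups H' H'') : ConjSubgroups H H'' := by
  obtain ⟨g, rfl⟩ := h
  obtain ⟨g', rfl⟩ := h'
  refine ⟨g' * g, ?_⟩
  rw [Subgroup.map_map]
  congr 1
  ext x
  simp [mul_assoc]

theorem WeakEquiv.conjSubgroups {l l' : List G} (h : WeakEquiv l l') :
    ConjSubgroups (monodromyGroup l) (monodromyGroup l') := by
  induction h with
  | rel l l' h =>
    rcases h with h | ⟨g, rfl⟩
    · exact .of_eq h.monodromyGroup_eq
    · refine ⟨g⁻¹, ?_⟩
      rw [monodromyGroup, monodromyGroup, MonoidHom.map_closure]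
      congr 1
      ext m
      simp
  | refl _ => exact .of_eq rfl
  | symm _ _ _ ih => exact ih.symm
  | trans _ _ _ _ _ ih ih' => exact ih.trans ih'

end BM

/-! ### Comparison of equivalence, monodromy groups and isotopy -/

namespace PlaneTree

open ModGroup

variable {k : ℕ} {t t' : PlaneTree k}

theorem exists_nextLeaf_eq {v : Fin (4 * k + 2)} (hv : t.IsLeaf v) :
    ∃ w, t.IsLeaf w ∧ t.nextLeaf w = v :=
  ⟨t.nextLeaf^[k + 1] v, t.isLeaf_iterate hv _, 
    (Function.iterate_succ_apply' t.nextLeaf (k + 1) v).symm.trans (t.iterate_nextLeaf hv)⟩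

/-- Powers of `U` applied to `w` meet no leaf end before the next leaf. -/
theorem vertexDist_le {w w' : Fin (4 * k + 2)} (hw' : t.IsLeaf w') {a : ℕ} (ha : 0 < a)
    (h : U ^ a • (Dessin.ofEnd w : t.Dessin) = Dessin.ofEnd w') : t.vertexDist w ≤ a := by
  rw [vertexDist, Nat.succ_le_iff, ← not_le, Nat.le_iff_lt_or_eq]
  rintro (h1 | rfl)
  · rw [← (Dessin.isPotential_ofEnd (t := t)).leftTurn_pow h1] at h
    rw [← Dessin.ofEnd.inj h] at hw'
    exact absurd (t.pathLength_le ha hw') (not_le.2 h1)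
  -- One step before the next leaf, the point is an end of the loop attached there.
  · have h2 := Dessin.U_pow_vertexDist_smul (t := t) w
    have h3 : U • (Dessin.loop _ (t.isLeaf_nextLeaf w) false : t.Dessin) =
        Dessin.ofEnd (t.nextLeaf w) := by
      rw [U, mul_smul, Dessin.Y_smul, Dessin.X_smul]; rfl
    rw [vertexDist, pow_succ', mul_smul, ← h3, smul_left_cancel_iff, h] at h2
    cases h2

theorem strongEquiv_of_smul_eq {w w' : Fin (4 * k + 2)} (hw : t.IsLeaf w) (hw' : t.IsLeaf w')
    {a : ℕ} (h : U ^ a • (Dessin.ofEnd w : t.Dessin) = Dessin.ofEnd w') (s : ℤ) :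
    BM.StrongEquiv (t.factorization (t.nextLeaf w) s)
      (t.factorization (t.nextLeaf w') (s - a)) := by
  induction a using Nat.strong_induction_on generalizing w s with
  | _ a ih =>
  rcases Nat.eq_zero_or_pos a with rfl | ha
  · rw [pow_zero, one_smul] at h
    rw [Dessin.ofEnd.inj h, Nat.cast_zero, sub_zero]
    exact .refl _
  · obtain ⟨b, rfl⟩ := Nat.exists_eq_add_of_le' (vertexDist_le hw' ha h)
    rw [pow_add, mul_smul, Dessin.U_pow_vertexDist_smul] at h
    have h1 := ih b (by rw [vertexDist]; omega) (t.isLeaf_nextLeaf w) h (s - t.vertexDist w)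
    rw [show s - ((b + t.vertexDist w : ℕ) : ℤ) = s - t.vertexDist w - b by push_cast; ring]
    exact (t.strongEquiv_nextLeaf hw s).trans _ _ _ h1

theorem strongEquiv_of_zpow_smul_eq {w w' : Fin (4 * k + 2)} (hw : t.IsLeaf w)
    (hw' : t.IsLeaf w') {s s' : ℤ}
    (h : U ^ s • (Dessin.ofEnd w : t.Dessin) = U ^ s' • Dessin.ofEnd w') :
    BM.StrongEquiv (t.factorization (t.nextLeaf w) s) (t.factorization (t.nextLeaf w') s') := by
  have key : ∀ {w w' : Fin (4 * k + 2)} {s s' : ℤ}, t.IsLeaf w → t.IsLeaf w' → s' ≤ s →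
      U ^ s • (Dessin.ofEnd w : t.Dessin) = U ^ s' • Dessin.ofEnd w' →
      BM.StrongEquiv (t.factorization (t.nextLeaf w) s)
        (t.factorization (t.nextLeaf w') s') := by
    intro w w' s s' hw hw' hs h
    obtain ⟨a, ha⟩ := Int.eq_ofNat_of_zero_le (sub_nonneg.2 hs)
    obtain rfl : s' = s - a := by omega
    refine strongEquiv_of_smul_eq hw hw' ?_ s
    rw [← inv_smul_eq_iff, smul_smul, ← zpow_neg, ← zpow_add,
      show -(s - (a : ℤ)) + s = a by ring, zpow_natCast] at h
    exact h
  rcases le_total s' s with hs | hs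
  · exact key hw hw' hs h
  · exact (key hw' hw hs h.symm).symm

theorem weakEquiv_factorization (v : Fin (4 * k + 2)) (s s' : ℤ) :
    BM.WeakEquiv (t.factorization v s) (t.factorization v s') := by
  refine BM.weakEquiv_of_isGlobalConj ⟨U ^ (s - s'), ?_⟩
  rw [factorization_eq, factorization_eq, List.map_map]
  refine List.map_congr_left fun i _ => ?_
  have := conj_conjA (s + t.dist v (k + 1) - t.dist v i) (-(s - s'))
  rw [zpow_neg, inv_inv] at this
  rw [Function.comp_apply, this]
  congr 1
  ring

theorem Isotopic.weakEquiv (h : t.Isotopic t') {v v' : Fin (4 * k + 2)} (hv : t.IsLeaf v)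
    (hv' : t'.IsLeaf v') (s s' : ℤ) :
    BM.WeakEquiv (t.factorization v s) (t'.factorization v' s') := by
  obtain ⟨e, h1, h2⟩ := h
  obtain ⟨hl, -, hf⟩ := factorization_eq_of_isotopy h1 h2
  rw [← hf]
  obtain ⟨w, hw, hwv⟩ := exists_nextLeaf_eq ((hl v).2 hv)
  obtain ⟨w', hw', rfl⟩ := exists_nextLeaf_eq hv'
  obtain ⟨j, -, hj⟩ := t'.exists_iterate_eq hw hw'
  have h3 := strongEquiv_of_smul_eq hw hw' (hj ▸ Dessin.U_pow_dist_smul w j) s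
  rw [hwv] at h3
  exact h3.weakEquiv.trans _ _ _ (weakEquiv_factorization _ _ _)

/-- Equality of the groups, as opposed to conjugacy, gives an isomorphism of dessins that preserves
base points; after transport to `t'` both factorizations have the same base point, and no global
conjugation is needed. -/
theorem strongEquiv_of_monodromyGroup_eq {v v' : Fin (4 * k + 2)} (hv : t.IsLeaf v)
    (hv' : t'.IsLeaf v') {s s' : ℤ}
    (h : BM.monodromyGroup (t.factorization v s) = BM.monodromyGroup (t'.factorization v' s')) :
    BM.StrongEquiv (t.factorization v s) (t'.factorization v' s') := by
  obtain ⟨w, hw, rfl⟩ := exists_nextLeaf_eq hv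
  obtain ⟨w', hw', rfl⟩ := exists_nextLeaf_eq hv'
  rw [monodromyGroup_eq_stabilizer _ hw, monodromyGroup_eq_stabilizer _ hw'] at h
  obtain ⟨f, hf, hf'⟩ := MulAction.exists_equiv_of_stabilizer_eq h
  obtain ⟨e, he, h1, h2⟩ := exists_isotopy f hf'
  obtain ⟨hl, hn, hfac⟩ := factorization_eq_of_isotopy h1 h2
  rw [hf', he] at hf
  rw [← hfac, ← hn]
  exact strongEquiv_of_zpow_smul_eq ((hl w).2 hw) hw' hf

/-- Conjugating a stabilizer moves the base point, and the isotopy does not see base points. -/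
theorem isotopic_of_conjSubgroups {v v' : Fin (4 * k + 2)} (hv : t.IsLeaf v)
    (hv' : t'.IsLeaf v') {s s' : ℤ}
    (h : BM.ConjSubgroups (BM.monodromyGroup (t.factorization v s))
      (BM.monodromyGroup (t'.factorization v' s'))) : t.Isotopic t' := by
  obtain ⟨w, hw, rfl⟩ := exists_nextLeaf_eq hv
  obtain ⟨w', hw', rfl⟩ := exists_nextLeaf_eq hv'
  obtain ⟨g, h⟩ := h
  rw [monodromyGroup_eq_stabilizer _ hw, monodromyGroup_eq_stabilizer _ hw',
    ← MulAction.stabilizer_smul_eq_stabilizer_map_conj] at h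
  obtain ⟨f, -, hf⟩ := MulAction.exists_equiv_of_stabilizer_eq h.symm
  obtain ⟨e, -, h1, h2⟩ := exists_isotopy f hf
  exact ⟨e, h1, h2⟩

theorem weakEquiv_iff_isotopic {v v' : Fin (4 * k + 2)} (hv : t.IsLeaf v)
    (hv' : t'.IsLeaf v') (s s' : ℤ) :
    BM.WeakEquiv (t.factorization v s) (t'.factorization v' s') ↔ t.Isotopic t' :=
  ⟨fun h => isotopic_of_conjSubgroups hv hv' h.conjSubgroups, fun h => h.weakEquiv hv hv' s s'⟩

theorem index_monodromyGroup {v : Fin (4 * k + 2)} (hv : t.IsLeaf v) (s : ℤ) :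
    (BM.monodromyGroup (t.factorization v s)).index = 6 * (k + 1) := by
  obtain ⟨w, hw, rfl⟩ := exists_nextLeaf_eq hv
  rw [monodromyGroup_eq_stabilizer _ hw, MulAction.index_stabilizer_of_transitive, Dessin.card_eq]

theorem ncard_weakClasses (k : ℕ) :
    (Quotient.mk (BM.weakSetoid ModGroup) '' family k).ncard = T k := by
  choose v hv using fun t : PlaneTree k => t.exists_isLeaf
  let F : Quotient (isotopySetoid k) → Quotient (BM.weakSetoid ModGroup) :=
    Quotient.lift (fun t => Quotient.mk _ (t.factorization (v t) 0)) fun t t' h =>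
      Quotient.sound (s := BM.weakSetoid ModGroup) (Isotopic.weakEquiv h (hv t) (hv t') 0 0)
  have hF : Function.Injective F := by
    intro a b
    induction a, b using Quotient.inductionOn₂ with
    | _ t t' =>
    intro h
    exact Quotient.sound (s := isotopySetoid k) ((weakEquiv_iff_isotopic (hv t) (hv t') 0 0).1
      (Quotient.exact (s := BM.weakSetoid ModGroup) h))
  have hrange : Quotient.mk (BM.weakSetoid ModGroup) '' family k = Set.range F := by
    ext q
    constructor
    · rintro ⟨_, ⟨t, w, s, hw, rfl⟩, rfl⟩
      exact ⟨Quotient.mk _ t, Quotient.sound (s := BM.weakSetoid ModGroup)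
        ((weakEquiv_iff_isotopic (hv t) hw 0 s).2 ((isotopySetoid k).refl t))⟩
    · rintro ⟨a, rfl⟩
      induction a using Quotient.ind with
      | _ t => exact ⟨_, ⟨t, v t, 0, hv t, rfl⟩, rfl⟩
  rw [hrange, ← Nat.card_coe_set_eq, ← Nat.card_congr (Equiv.ofInjective F hF), T]

end PlaneTree

theorem theorem1p4 (k : ℕ) :
    -- the common properties of the factorizations in question
    (∀ l ∈ PlaneTree.family k,
      l.length = k + 2 ∧ BM.IsSimple l ∧
      BM.atInfinity l = (ModGroup.X * ModGroup.Y) ^ (-(5 * (k : ℤ)) - 4) ∧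
      (BM.monodromyGroup l).index = 6 * (k + 1)) ∧
    -- strong equivalence is detected by the monodromy group
    (∀ l ∈ PlaneTree.family k, ∀ l' ∈ PlaneTree.family k,
      (BM.StrongEquiv l l' ↔ BM.monodromyGroup l = BM.monodromyGroup l')) ∧
    -- weak equivalence is detected by the conjugacy class of the monodromy group
    (∀ l ∈ PlaneTree.family k, ∀ l' ∈ PlaneTree.family k,
      (BM.WeakEquiv l l' ↔
        BM.ConjSubgroups (BM.monodromyGroup l) (BM.monodromyGroup l'))) ∧
    -- the weak equivalence classes correspond to the isotopy classes of trees
    (∀ (t t' : PlaneTree k) (v v' : Fin (4 * k + 2)) (s s' : ℤ), t.IsLeaf v → t'.IsLeaf v' →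
      (BM.WeakEquiv (t.factorization v s) (t'.factorization v' s') ↔ t.Isotopic t')) ∧
    -- there are exactly `T(k)` weak equivalence classes
    (Quotient.mk (BM.weakSetoid ModGroup) '' PlaneTree.family k).ncard = PlaneTree.T k := by
  refine ⟨?_, ?_, ?_, fun t t' v v' s s' hv hv' => PlaneTree.weakEquiv_iff_isotopic hv hv' s s',
    PlaneTree.ncard_weakClasses k⟩
  · rintro _ ⟨t, v, s, hv, rfl⟩
    exact ⟨by simp [PlaneTree.factorization_eq], t.isSimple_factorization v s,
      t.atInfinity_factorization hv s, PlaneTree.index_monodromyGroup hv s⟩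
  · rintro _ ⟨t, v, s, hv, rfl⟩ _ ⟨t', v', s', hv', rfl⟩
    exact ⟨fun h => h.monodromyGroup_eq, PlaneTree.strongEquiv_of_monodromyGroup_eq hv hv'⟩
  · rintro _ ⟨t, v, s, hv, rfl⟩ _ ⟨t', v', s', hv', rfl⟩
    exact ⟨fun h => h.conjSubgroups, fun h =>
      (PlaneTree.isotopic_of_conjSubgroups hv hv' h).weakEquiv hv hv' s s'⟩
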